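/- Let $n\ge 1$ be an integer and, for $j=1,\dots,n$, let $0<r_j<\infty$, $1\le p_j<\infty$, $1\le\theta_j\le\infty$ and let $k_j>r_j$ be an integer. Put $$r=n\Big(\sum_{j=1}^n\frac1{r_j}\Big)^{-1},\quad p=\frac nr\Big(\sum_{j=1}^n\frac1{p_jr_j}\Big)^{-1},\quad \theta=\frac nr\Big(\sum_{j=1}^n\frac1{\theta_jr_j}\Big)^{-1},\quad \beta_j=\frac1{r_j}\Big(\frac rn+\frac1{p_j}-\frac1p\Big)$$ (with $1/\infty=0$, and $\theta=\infty$ if all $\theta_j=\infty$). Assume that $\beta_j>0$ for all $j$ and that $p<n/r$, and put $q^*=np/(n-rp)$. For measurable $f$ on $\mathbb R^n$ let $f^*(t)=\inf\{y\ge0: |\{|f|>y\}|\le t\}$ be its non-increasing rearrangement, let $\|f\|_{q^*,\theta}=\big(\int_0^\infty (t^{1/q^*}f^*(t))^{\theta}\,\frac{dt}t\big)^{1/\theta}$ (the essential supremum of $t^{1/q^*}f^*(t)$ over $t>0$ if $\theta=\infty$) be its Lorentz norm, let $\Delta_j^{k}(h)f(x)=\sum_{i=0}^{k}(-1)^{k-i}\binom{k}{i}f(x+ihe_j)$,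 and let $$\|f\|_{b^{r_j}_{p_j,\theta_j;j}}=\Big(\int_0^\infty\big[h^{-r_j}\|\Delta_j^{k_j}(h)f\|_{L^{p_j}}\big]^{\theta_j}\frac{dh}h\Big)^{1/\theta_j}$$ (the essential supremum over $h>0$ if $\theta_j=\infty$). Both quantities take values in $[0,\infty]$. Then there is a finite constant $c$, depending only on $n$ and the $r_j,p_j,\theta_j,k_j$, such that $$\|f\|_{q^*,\theta}\le c\prod_{j=1}^n\big[\|f\|_{b^{r_j}_{p_j,\theta_j;j}}\big]^{\frac{r}{nr_j}}$$ for every (real- or complex-valued) measurable function $f$ on $\mathbb R^n$ that satisfies one of the following: (a) $f$ is locally integrable and $|\{x:|f(x)|>y\}|<\infty$ for every $y>0$; or (b) $f\in L^{p_0}(\mathbb R^n)$ for some $0<p_0<q^*$. (In the product, $0\cdot\infty=0$.) -/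

import Mathlib

open MeasureTheory Set
open scoped ENNReal NNReal

namespace AnisoBesov

/-- The measure `du/u` on the half line `(0, ∞)`. -/
noncomputable def dilationMeasure : Measure ℝ :=
  (volume.restrict (Ioi (0 : ℝ))).withDensity fun u => ENNReal.ofReal u⁻¹

/-- The norm of `L^θ((0, ∞), du/u)`, `0 < θ ≤ ∞`, of a nonnegative extended function
(for `θ = ∞` it is the essential supremum). -/
noncomputable def scriptLNorm (θ : ℝ≥0∞) (g : ℝ → ℝ≥0∞) : ℝ≥0∞ :=
  eLpNorm g θ dilationMeasure

section Functions

variable {n : ℕ} {𝕜 : Type*} [RCLike 𝕜]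

/-- The distribution function `λ_f(y) = |{x : |f(x)| > y}|`. -/
noncomputable def distribution (f : (Fin n → ℝ) → 𝕜) (y : ℝ≥0∞) : ℝ≥0∞ :=
  volume {x | y < ‖f x‖ₑ}

/-- The class `S₀(ℝⁿ)`: (Lebesgue) measurable functions with `λ_f(y) < ∞` for every `y > 0`. -/
def MemS0 (f : (Fin n → ℝ) → 𝕜) : Prop :=
  AEStronglyMeasurable f volume ∧ ∀ y : ℝ, 0 < y → distribution f (ENNReal.ofReal y) < ∞

/-- The non-increasing rearrangement `f*(t) = inf {y ≥ 0 : λ_f(y) ≤ t}`. -/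
noncomputable def rearrangement (f : (Fin n → ℝ) → 𝕜) (t : ℝ) : ℝ≥0∞ :=
  sInf {y : ℝ≥0∞ | distribution f y ≤ ENNReal.ofReal t}

/-- The Lorentz (quasi-)norm `‖f‖_{q,θ} = ‖t^{1/q} f*(t)‖_{L^θ(dt/t)}`, `0 < θ ≤ ∞`. -/
noncomputable def lorentzNorm (q : ℝ) (θ : ℝ≥0∞) (f : (Fin n → ℝ) → 𝕜) : ℝ≥0∞ :=
  scriptLNorm θ fun t => ENNReal.ofReal (t ^ (1 / q)) * rearrangement f t

/-- The difference of order `k` and step `h` in the direction of the `j`-th coordinate. -/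
noncomputable def difference (j : Fin n) (k : ℕ) (h : ℝ) (f : (Fin n → ℝ) → 𝕜) :
    (Fin n → ℝ) → 𝕜 :=
  fun x => ∑ i ∈ Finset.range (k + 1),
    (-1 : 𝕜) ^ (k - i) * (k.choose i : 𝕜) * f (x + Pi.single j ((i : ℝ) * h))

/-- The Besov seminorm of `b^r_{p,θ;j}`, computed with differences of order `k`:
`‖ h^{-r} ‖Δ_j^k(h) f‖_p ‖_{L^θ(dh/h)}`. -/
noncomputable def besovSeminorm (j : Fin n) (k : ℕ) (r p : ℝ) (θ : ℝ≥0∞)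
    (f : (Fin n → ℝ) → 𝕜) : ℝ≥0∞ :=
  scriptLNorm θ fun h =>
    ENNReal.ofReal (h ^ (-r)) * eLpNorm (difference j k h f) (ENNReal.ofReal p) volume

end Functions

section Parameters

variable {n : ℕ}

/-- `r = n (∑ 1/r_j)⁻¹`. -/
noncomputable def meanR (r : Fin n → ℝ) : ℝ :=
  n * (∑ j, 1 / r j)⁻¹

/-- `p = (n/r) (∑ 1/(p_j r_j))⁻¹`. -/
noncomputable def meanP (r p : Fin n → ℝ) : ℝ :=
  n / meanR r * (∑ j, 1 / (p j * r j))⁻¹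

/-- `θ = (n/r) (∑ 1/(θ_j r_j))⁻¹`, with `1/∞ = 0` and `1/0 = ∞`. -/
noncomputable def meanTheta (r : Fin n → ℝ) (θ : Fin n → ℝ≥0∞) : ℝ≥0∞ :=
  ENNReal.ofReal (n / meanR r) * (∑ j, (θ j * ENNReal.ofReal (r j))⁻¹)⁻¹

/-- `β_j = (1/r_j) (r/n + 1/p_j - 1/p)`. -/
noncomputable def beta (r p : Fin n → ℝ) (j : Fin n) : ℝ :=
  1 / r j * (meanR r / n + 1 / p j - 1 / meanP r p)

/-- The limit exponent `q* = n p / (n - r p)`. -/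
noncomputable def qStar (r p : Fin n → ℝ) : ℝ :=
  n * meanP r p / (n - meanR r * meanP r p)

end Parameters

end AnisoBesov

open AnisoBesov

/-! Substituting `h = e^w`, `t = e^u` turns every `L^θ(dh/h)` norm into an `L^θ(ℝ)` norm, with
moduli `g_j(w) = e^{-r_j w} ‖Δ_j^{k_j}(e^w) f‖_{p_j}`. Convolution with `e^{-ε|·|}` replaces `g_j`
by a majorant, in the sense of local averages, of the form `e^{ℓ_j}` with `ℓ_j` ε-Lipschitz and
comparable norm (`exists_log_lipschitz_majorant`).

For each `u` the volume `t = e^u` is distributed over the axes as steps of size `e^{v_j}`, `∑ v_j =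
u`, so that `r_j v_j + ℓ_j(v_j) = r_j β_j u + L(u)` with `L` independent of `j` (`exists_balanced`).
Since `r_j β_j = 1/p_j - 1/q*`, most steps `h_j` near `e^{v_j}` have `‖Δ_j(h_j) f‖_{p_j} ≲ t^{1/p_j}
X(u)`, where `X(u) = e^{-u/q* + L(u)}`. By Chebyshev all these differences are `≲ X(u)` outside one
set of measure a small multiple of `t`, hence so is `f - S_h f`, where `S_h` is the product over `j`
of the operators `1 - (-1)^{k_j} Δ_j^{k_j}(h_j)`.

The scales `t, 2t, 4t, …` are then linked at a single point `x` (`level_le_of_chain`). The operators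
commute, so `S_h - S_h' = S_h(1 - S_h') - S_h'(1 - S_h)`; and `S_h g(x)`, as a function of `h`,
obeys a weak-type bound in terms of `g`. Thus `S_h f(x)` remains close to `f(x)` for at least half
of the steps at every scale, while it must become small for some of them because the level sets of
`f` have finite measure. Hence `f*(t)` is at most a constant times the sum of `X` over these scales,
which is geometric because `L` varies more slowly than `u/q*`. So `t^{1/q*} f*(t) ≲ e^{L(u)} = ∏
e^{w_j ℓ_j(v_j(u))}` with `w_j = r/(n r_j)`. Hölder's inequality and the change of variable `u ↦
v_j(u)`, expanding up to a constant since `β_j > 0`, finish the proof. -/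

namespace AnisoBesov

/-! ### Logarithmic variables, double counting, changes of variable and Hölder's inequality. -/

section Measures

theorem measurableEmbedding_exp : MeasurableEmbedding Real.exp :=
  Real.continuous_exp.measurableEmbedding Real.exp_injective

theorem dilationMeasure_eq_map : dilationMeasure = Measure.map Real.exp volume := by
  ext s hs
  rw [dilationMeasure, withDensity_apply _ hs, Measure.restrict_restrict hs,
    Measure.map_apply Real.measurable_exp hs]
  have h1 : s ∩ Ioi 0 = Real.exp '' (Real.exp ⁻¹' s) := by
    rw [image_preimage_eq_inter_range, Real.range_exp]
  rw [h1, lintegral_image_eq_lintegral_abs_deriv_mul (Real.measurable_exp hs)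
    (fun x _ => (Real.hasDerivAt_exp x).hasDerivWithinAt) Real.exp_injective.injOn]
  have h2 : ∀ x : ℝ, ENNReal.ofReal |Real.exp x| * ENNReal.ofReal (Real.exp x)⁻¹ = 1 := by
    intro x
    rw [abs_of_pos (Real.exp_pos x), ← ENNReal.ofReal_mul (Real.exp_pos x).le,
      mul_inv_cancel₀ (Real.exp_pos x).ne', ENNReal.ofReal_one]
  simp only [h2]
  simp

theorem scriptLNorm_eq_exp (θ : ℝ≥0∞) (g : ℝ → ℝ≥0∞) :
    scriptLNorm θ g = eLpNorm (fun v => g (Real.exp v)) θ volume := by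
  rw [scriptLNorm, dilationMeasure_eq_map, measurableEmbedding_exp.eLpNorm_map_measure]
  rfl

/-- Double counting for a measurable relation between two sets. -/
theorem mul_measure_le_of_sections {α β : Type*} [MeasurableSpace α] [MeasurableSpace β]
    {μ : Measure α} {ν : Measure β} [SFinite μ] [SFinite ν] {P : Set (α × β)}
    (hP : MeasurableSet P) {s : Set α} {t : Set β} (hs : MeasurableSet s) (ht : MeasurableSet t)
    {a b : ℝ≥0∞} (h1 : ∀ x ∈ s, a ≤ ν {y ∈ t | (x, y) ∈ P})
    (h2 : ∀ y ∈ t, μ {x ∈ s | (x, y) ∈ P} ≤ b) : a * μ s ≤ b * ν t := by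
  set Q : Set (α × β) := (s ×ˢ t) ∩ P with hQ
  have hQm : MeasurableSet Q := (hs.prod ht).inter hP
  have e1 : (μ.prod ν) Q = ∫⁻ x, ν (Prod.mk x ⁻¹' Q) ∂μ := Measure.prod_apply hQm
  have e2 : (μ.prod ν) Q = ∫⁻ y, μ ((fun x => (x, y)) ⁻¹' Q) ∂ν := Measure.prod_apply_symm hQm
  calc a * μ s = ∫⁻ _ in s, a ∂μ := by simp
    _ ≤ ∫⁻ x in s, ν (Prod.mk x ⁻¹' Q) ∂μ := by
        refine setLIntegral_mono' hs fun x hx => (h1 x hx).trans (measure_mono ?_)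
        rintro y ⟨hy, hxy⟩
        exact ⟨⟨hx, hy⟩, hxy⟩
    _ ≤ ∫⁻ x, ν (Prod.mk x ⁻¹' Q) ∂μ := setLIntegral_le_lintegral _ _
    _ = ∫⁻ y, μ ((fun x => (x, y)) ⁻¹' Q) ∂ν := by rw [← e1, e2]
    _ ≤ ∫⁻ y, t.indicator (fun _ => b) y ∂ν := by
        refine lintegral_mono fun y => ?_
        by_cases hy : y ∈ t
        · rw [indicator_of_mem hy]
          refine (measure_mono ?_).trans (h2 y hy)
          rintro x ⟨⟨hx, _⟩, hxy⟩
          exact ⟨hx, hxy⟩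
        · rw [indicator_of_notMem hy]
          have : (fun x => (x, y)) ⁻¹' Q = ∅ := by
            ext x
            simp [hQ, hy]
          simp [this]
    _ = b * ν t := by simp [lintegral_indicator ht]

/-- The map `h ↦ x + a h` multiplies volume by `∏ a_i ≥ 1`. It transfers distribution bounds from
the space variable to the step variable. -/
theorem volume_preimage_add_mul_le {n : ℕ} (x : Fin n → ℝ) {a : Fin n → ℝ} (ha : ∀ i, 1 ≤ a i)
    {s : Set (Fin n → ℝ)} (hs : MeasurableSet s) :
    volume {h : Fin n → ℝ | x + a * h ∈ s} ≤ volume s := by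
  classical
  have hd : 1 ≤ (Matrix.diagonal a).det := by
    rw [Matrix.det_diagonal]
    exact Finset.prod_induction a (fun y => 1 ≤ y) (fun _ _ => one_le_mul_of_one_le_of_one_le)
      le_rfl (fun i _ => ha i)
  have h0 := Real.smul_map_diagonal_volume_pi (D := a) (by linarith)
  have hm : Measurable (Matrix.toLin' (Matrix.diagonal a)) :=
    (LinearMap.continuous_of_finiteDimensional _).measurable
  have hs' : MeasurableSet ((fun y => x + y) ⁻¹' s) := measurable_const_add x hs
  calc volume {h : Fin n → ℝ | x + a * h ∈ s}
      = Measure.map (Matrix.toLin' (Matrix.diagonal a)) volume ((fun y => x + y) ⁻¹' s) := by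
        rw [Measure.map_apply hm hs']
        congr 1
        ext h
        simp only [mem_ofPred_eq, mem_preimage, Matrix.toLin'_apply]
        have : Matrix.mulVec (Matrix.diagonal a) h = a * h := by
          ext i
          rw [Matrix.mulVec_diagonal, Pi.mul_apply]
        rw [this]
    _ ≤ (ENNReal.ofReal |(Matrix.diagonal a).det| •
          Measure.map (Matrix.toLin' (Matrix.diagonal a)) volume) ((fun y => x + y) ⁻¹' s) := by
        rw [Measure.smul_apply, smul_eq_mul]
        refine le_mul_of_one_le_left zero_le ?_
        rw [← ENNReal.ofReal_one]
        exact ENNReal.ofReal_le_ofReal (hd.trans (le_abs_self _))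
    _ = volume s := by rw [h0, measure_preimage_add]

/-- Lebesgue measure on the line is one-dimensional Hausdorff measure, for which antilipschitz maps
control preimages; no differentiability of `v` is needed. -/
theorem map_volume_le_of_expanding {v : ℝ → ℝ} {c : ℝ≥0} (hm : Measurable v)
    (hv : AntilipschitzWith c v) : Measure.map v volume ≤ (c : ℝ≥0∞) • volume := by
  refine Measure.le_iff.2 fun s hs => ?_
  rw [Measure.map_apply hm hs, Measure.smul_apply, smul_eq_mul]
  have := hv.hausdorffMeasure_preimage_le (d := 1) zero_le_one s
  rwa [hausdorffMeasure_real, ENNReal.rpow_one] at this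

theorem eLpNorm_comp_le_of_expanding {v : ℝ → ℝ} {c : ℝ≥0} (hm : Measurable v)
    (hv : AntilipschitzWith c v) (hc : 1 ≤ c) {θ : ℝ≥0∞} (hθ : 1 ≤ θ) {g : ℝ → ℝ≥0∞}
    (hg : Measurable g) :
    eLpNorm (fun u => g (v u)) θ volume ≤ c * eLpNorm g θ volume := by
  have h1 : eLpNorm (fun u => g (v u)) θ volume = eLpNorm g θ (Measure.map v volume) :=
    (eLpNorm_map_measure hg.aestronglyMeasurable hm.aemeasurable).symm
  rw [h1]
  refine (eLpNorm_mono_measure g (map_volume_le_of_expanding hm hv)).trans ?_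
  have hc' : (1 : ℝ≥0∞) ≤ c := by exact_mod_cast hc
  rw [eLpNorm_smul_measure_of_ne_zero (by positivity), smul_eq_mul]
  gcongr
  calc (c : ℝ≥0∞) ^ (1 / θ).toReal ≤ (c : ℝ≥0∞) ^ (1 : ℝ) := by
        refine ENNReal.rpow_le_rpow_of_exponent_le hc' ?_
        rw [← ENNReal.toReal_one]
        refine ENNReal.toReal_mono ENNReal.one_ne_top ?_
        rw [one_div]
        exact ENNReal.inv_le_one.2 hθ
    _ = c := ENNReal.rpow_one _

theorem eLpNorm_ennreal_top {α : Type*} [MeasurableSpace α] {μ : Measure α} (g : α → ℝ≥0∞) :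
    eLpNorm g ∞ μ = essSup g μ := by
  simp [eLpNormEssSup]

theorem eLpNorm_ennreal_eq {α : Type*} [MeasurableSpace α] {μ : Measure α} (g : α → ℝ≥0∞)
    {θ : ℝ≥0∞} (h0 : θ ≠ 0) (h1 : θ ≠ ∞) :
    eLpNorm g θ μ = (∫⁻ x, g x ^ θ.toReal ∂μ) ^ (1 / θ.toReal) := by
  simp [eLpNorm_eq_lintegral_rpow_enorm_toReal h0 h1]

/-- Hölder's inequality for a weighted geometric mean. -/
theorem eLpNorm_prod_rpow_le {ι α : Type*} [Fintype ι] [MeasurableSpace α] {μ : Measure α}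
    {g : ι → α → ℝ≥0∞} (hg : ∀ i, Measurable (g i)) {w : ι → ℝ} (hw : ∀ i, 0 < w i)
    {θ : ι → ℝ≥0∞} (hθ : ∀ i, θ i ≠ 0) {Θ : ℝ≥0∞}
    (hΘ : Θ⁻¹ = ∑ i, ENNReal.ofReal (w i) * (θ i)⁻¹) :
    eLpNorm (fun x => ∏ i, g i x ^ w i) Θ μ ≤ ∏ i, eLpNorm (g i) (θ i) μ ^ w i := by
  classical
  have hae : ∀ᵐ x ∂μ, ∀ i, θ i = ∞ → g i x ≤ eLpNorm (g i) (θ i) μ := by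
    rw [ae_all_iff]
    intro i
    by_cases h : θ i = ∞
    · rw [h, eLpNorm_ennreal_top]
      filter_upwards [ENNReal.ae_le_essSup (g i)] with x hx _ using hx
    · exact Filter.Eventually.of_forall fun _ h' => absurd h' h
  by_cases hall : ∀ i, θ i = ∞
  · have : Θ = ∞ := by
      rw [← ENNReal.inv_eq_zero, hΘ]
      simp [hall]
    rw [this, eLpNorm_ennreal_top]
    refine essSup_le_of_ae_le _ ?_
    filter_upwards [hae] with x hx
    exact Finset.prod_le_prod' fun i _ => ENNReal.rpow_le_rpow (hx i (hall i)) (hw i).le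
  push Not at hall
  obtain ⟨i₀, hi₀⟩ := hall
  have hinv : ∀ i, (θ i)⁻¹ ≠ ∞ := fun i => ENNReal.inv_ne_top.2 (hθ i)
  have hΘt : Θ ≠ ∞ := by
    intro h
    rw [h, ENNReal.inv_top, eq_comm, Finset.sum_eq_zero_iff] at hΘ
    have := hΘ i₀ (Finset.mem_univ _)
    rw [mul_eq_zero, ENNReal.inv_eq_zero, ENNReal.ofReal_eq_zero] at this
    rcases this with h | h
    · exact absurd (hw i₀) (not_lt.2 h)
    · exact hi₀ h
  have hΘ0 : Θ ≠ 0 := by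
    intro h
    rw [h, ENNReal.inv_zero, eq_comm] at hΘ
    exact ENNReal.sum_ne_top.2 (fun i _ => ENNReal.mul_ne_top ENNReal.ofReal_ne_top (hinv i)) hΘ
  set T := Θ.toReal with hT
  have hTpos : 0 < T := ENNReal.toReal_pos hΘ0 hΘt
  -- Factors with infinite exponent are bounded a.e. by the constant `c`; the others enter Hölder's
  -- inequality with exponents `w i * T / θ i`, which sum to 1.
  set J : Finset ι := Finset.univ.filter fun i => θ i ≠ ∞ with hJ
  set c : ℝ≥0∞ := ∏ i ∈ Jᶜ, eLpNorm (g i) (θ i) μ ^ w i with hc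
  have hsum : ∑ i ∈ J, w i * T / (θ i).toReal = 1 := by
    have h1 : (1 : ℝ) / T = ∑ i, w i / (θ i).toReal := by
      have := congrArg ENNReal.toReal hΘ
      rw [ENNReal.toReal_inv, ENNReal.toReal_sum
        (fun i _ => ENNReal.mul_ne_top ENNReal.ofReal_ne_top (hinv i))] at this
      rw [one_div, this]
      refine Finset.sum_congr rfl fun i _ => ?_
      rw [ENNReal.toReal_mul, ENNReal.toReal_ofReal (hw i).le, ENNReal.toReal_inv, div_eq_mul_inv]
    have h2 : ∑ i ∈ J, w i / (θ i).toReal = ∑ i, w i / (θ i).toReal := by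
      refine Finset.sum_subset (Finset.subset_univ _) fun i _ hi => ?_
      have : θ i = ∞ := by simpa [hJ] using hi
      simp [this]
    calc ∑ i ∈ J, w i * T / (θ i).toReal = T * ∑ i ∈ J, w i / (θ i).toReal := by
          rw [Finset.mul_sum]
          exact Finset.sum_congr rfl fun i _ => by ring
      _ = 1 := by rw [h2, ← h1, mul_one_div_cancel hTpos.ne']
  have hθr : ∀ i ∈ J, 0 < (θ i).toReal := fun i hi =>
    ENNReal.toReal_pos (hθ i) (Finset.mem_filter.1 hi).2
  have hle : ∫⁻ x, (∏ i, g i x ^ w i) ^ T ∂μ ≤ (∏ i, eLpNorm (g i) (θ i) μ ^ w i) ^ T := by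
    calc ∫⁻ x, (∏ i, g i x ^ w i) ^ T ∂μ
        ≤ ∫⁻ x, c ^ T * ∏ i ∈ J, (g i x ^ (θ i).toReal) ^ (w i * T / (θ i).toReal) ∂μ := by
          refine lintegral_mono_ae ?_
          filter_upwards [hae] with x hx
          rw [← Finset.prod_mul_prod_compl J, ENNReal.mul_rpow_of_nonneg _ _ hTpos.le, mul_comm]
          refine mul_le_mul' (ENNReal.rpow_le_rpow ?_ hTpos.le) (le_of_eq ?_)
          · refine Finset.prod_le_prod' fun i hi => ENNReal.rpow_le_rpow (hx i ?_) (hw i).le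
            simpa [hJ] using hi
          · rw [← ENNReal.prod_rpow_of_nonneg hTpos.le]
            refine Finset.prod_congr rfl fun i hi => ?_
            rw [← ENNReal.rpow_mul, ← ENNReal.rpow_mul]
            congr 1
            field_simp [(hθr i hi).ne']
      _ = c ^ T * ∫⁻ x, ∏ i ∈ J, (g i x ^ (θ i).toReal) ^ (w i * T / (θ i).toReal) ∂μ := by
          refine lintegral_const_mul _ ?_
          exact Finset.measurable_prod _ fun i _ => ((hg i).pow_const _).pow_const _
      _ ≤ c ^ T * ∏ i ∈ J, (∫⁻ x, g i x ^ (θ i).toReal ∂μ) ^ (w i * T / (θ i).toReal) := by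
          gcongr
          refine ENNReal.lintegral_prod_norm_pow_le J
            (fun i _ => ((hg i).pow_const _).aemeasurable) hsum fun i hi => ?_
          have := hw i
          have := hθr i hi
          positivity
      _ = (∏ i, eLpNorm (g i) (θ i) μ ^ w i) ^ T := by
          rw [← Finset.prod_mul_prod_compl J, ENNReal.mul_rpow_of_nonneg _ _ hTpos.le, mul_comm]
          congr 1
          rw [← ENNReal.prod_rpow_of_nonneg hTpos.le]
          refine Finset.prod_congr rfl fun i hi => ?_
          rw [eLpNorm_ennreal_eq _ (hθ i) (Finset.mem_filter.1 hi).2, ← ENNReal.rpow_mul,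
            ← ENNReal.rpow_mul]
          congr 1
          field_simp
  rw [eLpNorm_ennreal_eq _ hΘ0 hΘt]
  calc (∫⁻ x, (∏ i, g i x ^ w i) ^ T ∂μ) ^ (1 / T)
      ≤ ((∏ i, eLpNorm (g i) (θ i) μ ^ w i) ^ T) ^ (1 / T) :=
        ENNReal.rpow_le_rpow hle (by positivity)
    _ = _ := by rw [← ENNReal.rpow_mul, mul_one_div_cancel hTpos.ne', ENNReal.rpow_one]

end Measures

/-! ### Majorants with Lipschitz logarithm. -/

section Smoothing

/-- Convolution with the two-sided exponential kernel `e^{-ε|v|}`. -/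
noncomputable def expSmoothing (ε : ℝ) (g : ℝ → ℝ≥0∞) (v : ℝ) : ℝ≥0∞ :=
  ∫⁻ w, ENNReal.ofReal (Real.exp (-(ε * |v - w|))) * g w

/-- The mass of the two-sided exponential kernel. -/
noncomputable def expMass (ε : ℝ) : ℝ≥0∞ :=
  ∫⁻ w : ℝ, ENNReal.ofReal (Real.exp (-(ε * |w|)))

theorem expMass_ne_top {ε : ℝ} (hε : 0 < ε) : expMass ε ≠ ∞ := by
  have h1 : IntegrableOn (fun w : ℝ => Real.exp (-(ε * |w|))) (Ioi 0) := by
    refine (exp_neg_integrableOn_Ioi 0 hε).congr_fun (fun w hw => ?_) measurableSet_Ioi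
    simp [abs_of_pos (mem_Ioi.1 hw)]
  have h2 : IntegrableOn (fun w : ℝ => Real.exp (-(ε * |w|))) (Iic 0) := by
    refine (integrableOn_exp_mul_Iic hε 0).congr_fun (fun w hw => ?_) measurableSet_Iic
    simp [abs_of_nonpos (mem_Iic.1 hw)]
  have h3 : Integrable (fun w : ℝ => Real.exp (-(ε * |w|))) := by
    rw [← integrableOn_univ, ← Iic_union_Ioi (a := (0 : ℝ))]
    exact h2.union h1
  exact h3.lintegral_lt_top.ne

theorem expMass_eq_left (ε v : ℝ) :
    ∫⁻ w : ℝ, ENNReal.ofReal (Real.exp (-(ε * |v - w|))) = expMass ε :=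
  lintegral_sub_left_eq_self (fun w : ℝ => ENNReal.ofReal (Real.exp (-(ε * |w|)))) v

theorem expMass_eq_right (ε w : ℝ) :
    ∫⁻ v : ℝ, ENNReal.ofReal (Real.exp (-(ε * |v - w|))) = expMass ε :=
  lintegral_sub_right_eq_self (fun w : ℝ => ENNReal.ofReal (Real.exp (-(ε * |w|)))) w

theorem measurable_expKernel (ε : ℝ) :
    Measurable fun z : ℝ × ℝ => ENNReal.ofReal (Real.exp (-(ε * |z.1 - z.2|))) :=
  ENNReal.measurable_ofReal.comp (by fun_prop)

theorem measurable_expSmoothing (ε : ℝ) {g : ℝ → ℝ≥0∞} (hg : Measurable g) :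
    Measurable (expSmoothing ε g) :=
  ((measurable_expKernel ε).mul (hg.comp measurable_snd)).lintegral_prod_right'

/-- A Harnack inequality inherited from the kernel by the triangle inequality. It makes the
logarithm of the smoothing `ε`-Lipschitz and spreads finiteness from one point to all. -/
theorem expSmoothing_le {ε : ℝ} (hε : 0 ≤ ε) (g : ℝ → ℝ≥0∞) (v v' : ℝ) :
    expSmoothing ε g v ≤ ENNReal.ofReal (Real.exp (ε * |v - v'|)) * expSmoothing ε g v' := by
  rw [expSmoothing, expSmoothing, ← lintegral_const_mul' _ _ ENNReal.ofReal_ne_top]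
  refine lintegral_mono fun w => ?_
  rw [← mul_assoc, ← ENNReal.ofReal_mul (Real.exp_pos _).le, ← Real.exp_add]
  gcongr
  have := abs_sub_le v' v w
  rw [abs_sub_comm v' v] at this
  nlinarith

/-- Jensen's inequality for the measure `e^{-ε|v-w|} dw`, of total mass `expMass ε`. -/
theorem expSmoothing_rpow_le (ε : ℝ) {g : ℝ → ℝ≥0∞} (hg : Measurable g) {q : ℝ} (hq : 1 ≤ q)
    (v : ℝ) :
    expSmoothing ε g v ^ q ≤
      expMass ε ^ (q - 1) * ∫⁻ w, ENNReal.ofReal (Real.exp (-(ε * |v - w|))) * g w ^ q := by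
  have hk : Measurable fun w : ℝ => ENNReal.ofReal (Real.exp (-(ε * |v - w|))) :=
    (measurable_expKernel ε).comp measurable_prodMk_left
  set ν : Measure ℝ := volume.withDensity
    fun w => ENNReal.ofReal (Real.exp (-(ε * |v - w|))) with hν
  have hq0 : 0 < q := by linarith
  have h := eLpNorm_le_eLpNorm_mul_rpow_measure_univ (μ := ν) (p := 1) (q := ENNReal.ofReal q)
    (by rw [← ENNReal.ofReal_one]; exact ENNReal.ofReal_le_ofReal hq) hg.aestronglyMeasurable
  rw [eLpNorm_ennreal_eq _ one_ne_zero ENNReal.one_ne_top,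
    eLpNorm_ennreal_eq _ (by simpa using hq0) ENNReal.ofReal_ne_top,
    ENNReal.toReal_ofReal hq0.le] at h
  simp only [ENNReal.toReal_one, ENNReal.rpow_one, div_one] at h
  have hu : ν univ = expMass ε := by
    rw [hν, withDensity_apply _ MeasurableSet.univ, setLIntegral_univ, expMass_eq_left]
  rw [hu, hν, lintegral_withDensity_eq_lintegral_mul _ hk hg,
    lintegral_withDensity_eq_lintegral_mul _ hk (hg.pow_const _)] at h
  calc expSmoothing ε g v ^ q ≤ _ := ENNReal.rpow_le_rpow h hq0.le
    _ = _ := by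
      rw [ENNReal.mul_rpow_of_nonneg _ _ hq0.le, ← ENNReal.rpow_mul, ← ENNReal.rpow_mul, mul_comm,
        one_div_mul_cancel hq0.ne', ENNReal.rpow_one, sub_mul, one_mul,
        one_div_mul_cancel hq0.ne']
      rfl

/-- Young's inequality for an `L¹` kernel: immediate for `θ = ∞`, otherwise the pointwise power
bound followed by Tonelli. -/
theorem eLpNorm_expSmoothing_le {ε : ℝ} (hε : 0 < ε) {g : ℝ → ℝ≥0∞} (hg : Measurable g)
    {θ : ℝ≥0∞} (hθ : 1 ≤ θ) :
    eLpNorm (expSmoothing ε g) θ volume ≤ expMass ε * eLpNorm g θ volume := by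
  by_cases htop : θ = ∞
  · rw [htop, eLpNorm_ennreal_top, eLpNorm_ennreal_top]
    refine essSup_le_of_ae_le _ (Filter.Eventually.of_forall fun v => ?_)
    calc expSmoothing ε g v
        ≤ ∫⁻ w, ENNReal.ofReal (Real.exp (-(ε * |v - w|))) * essSup g volume := by
          refine lintegral_mono_ae ?_
          filter_upwards [ENNReal.ae_le_essSup g] with w hw
          gcongr
      _ = expMass ε * essSup g volume := by
          have hk : Measurable fun w : ℝ => ENNReal.ofReal (Real.exp (-(ε * |v - w|))) :=
            (measurable_expKernel ε).comp measurable_prodMk_left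
          rw [lintegral_mul_const _ hk, expMass_eq_left]
  set q := θ.toReal with hq
  have hθ0 : θ ≠ 0 := (zero_lt_one.trans_le hθ).ne'
  have hq1 : 1 ≤ q := by
    rw [hq, ← ENNReal.toReal_one]
    exact ENNReal.toReal_mono htop hθ
  have hq0 : 0 < q := by linarith
  rw [eLpNorm_ennreal_eq _ hθ0 htop, eLpNorm_ennreal_eq _ hθ0 htop]
  have key : ∫⁻ v, expSmoothing ε g v ^ q ≤ expMass ε ^ q * ∫⁻ w, g w ^ q := by
    calc ∫⁻ v, expSmoothing ε g v ^ q
        ≤ ∫⁻ v, expMass ε ^ (q - 1) *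
            ∫⁻ w, ENNReal.ofReal (Real.exp (-(ε * |v - w|))) * g w ^ q :=
          lintegral_mono fun v => expSmoothing_rpow_le ε hg hq1 v
      _ = expMass ε ^ (q - 1) *
            ∫⁻ v, ∫⁻ w, ENNReal.ofReal (Real.exp (-(ε * |v - w|))) * g w ^ q :=
          lintegral_const_mul' _ _
            (ENNReal.rpow_ne_top_of_nonneg (by linarith) (expMass_ne_top hε))
      _ = expMass ε ^ (q - 1) *
            ∫⁻ w, ∫⁻ v, ENNReal.ofReal (Real.exp (-(ε * |v - w|))) * g w ^ q := by
          rw [lintegral_lintegral_swap]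
          exact ((measurable_expKernel ε).mul
            ((hg.pow_const q).comp measurable_snd)).aemeasurable
      _ = expMass ε ^ (q - 1) * ∫⁻ w, expMass ε * g w ^ q := by
          congr 1
          refine lintegral_congr fun w => ?_
          have hk : Measurable fun v : ℝ => ENNReal.ofReal (Real.exp (-(ε * |v - w|))) :=
            (measurable_expKernel ε).comp measurable_prodMk_right
          rw [lintegral_mul_const _ hk, expMass_eq_right]
      _ = expMass ε ^ q * ∫⁻ w, g w ^ q := by
          rw [lintegral_const_mul _ (hg.pow_const q), ← mul_assoc]
          congr 1
          nth_rewrite 2 [← ENNReal.rpow_one (expMass ε)]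
          rw [← ENNReal.rpow_add_of_nonneg _ _ (by linarith) zero_le_one, sub_add_cancel]
  calc (∫⁻ v, expSmoothing ε g v ^ q) ^ (1 / q)
      ≤ (expMass ε ^ q * ∫⁻ w, g w ^ q) ^ (1 / q) := ENNReal.rpow_le_rpow key (by positivity)
    _ = _ := by
      rw [ENNReal.mul_rpow_of_nonneg _ _ (by positivity), ← ENNReal.rpow_mul,
        mul_one_div_cancel hq0.ne', ENNReal.rpow_one]

theorem ae_ne_top_of_eLpNorm_ne_top {α : Type*} [MeasurableSpace α] {μ : Measure α}
    {g : α → ℝ≥0∞} (hg : Measurable g) {θ : ℝ≥0∞} (hθ : θ ≠ 0) (h : eLpNorm g θ μ ≠ ∞) :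
    ∀ᵐ x ∂μ, g x ≠ ∞ := by
  by_cases htop : θ = ∞
  · rw [htop, eLpNorm_ennreal_top] at h
    filter_upwards [ENNReal.ae_le_essSup g] with x hx hx'
    rw [hx', top_le_iff] at hx
    exact h hx
  · have hq := ENNReal.toReal_pos hθ htop
    rw [eLpNorm_ennreal_eq _ hθ htop, Ne, ENNReal.rpow_eq_top_iff_of_pos (by positivity)] at h
    filter_upwards [ae_lt_top (hg.pow_const _) h] with x hx hx'
    rw [hx', ENNReal.top_rpow_of_pos hq] at hx
    exact lt_irrefl _ hx

/-- A function of `L^θ(ℝ)` is dominated, in the sense of local averages, by a function `e^ℓ` of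
comparable norm with `ℓ` Lipschitz. -/
theorem exists_log_lipschitz_majorant {ε : ℝ} (hε : 0 < ε) (hε1 : ε ≤ 1) {g : ℝ → ℝ≥0∞}
    (hg : Measurable g) {θ : ℝ≥0∞} (hθ : 1 ≤ θ) (h0 : eLpNorm g θ volume ≠ 0)
    (htop : eLpNorm g θ volume ≠ ∞) :
    ∃ ℓ : ℝ → ℝ, (∀ v v', |ℓ v - ℓ v'| ≤ ε * |v - v'|) ∧
      eLpNorm (fun v => ENNReal.ofReal (Real.exp (ℓ v))) θ volume
        ≤ expMass ε * eLpNorm g θ volume ∧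
      ∀ v, ∫⁻ w in Icc v (v + Real.log 2), g w ≤ ENNReal.ofReal (2 * Real.exp (ℓ v)) := by
  have hθ0 : θ ≠ 0 := (zero_lt_one.trans_le hθ).ne'
  have hbound := eLpNorm_expSmoothing_le hε hg hθ
  have hfin : ∀ v, expSmoothing ε g v ≠ ∞ := by
    have hae := ae_ne_top_of_eLpNorm_ne_top (measurable_expSmoothing ε hg) hθ0
      (ne_top_of_le_ne_top (ENNReal.mul_ne_top (expMass_ne_top hε) htop) hbound)
    obtain ⟨v₀, hv₀⟩ := hae.exists
    exact fun v => ne_top_of_le_ne_top (ENNReal.mul_ne_top ENNReal.ofReal_ne_top hv₀)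
      (expSmoothing_le hε.le g v v₀)
  -- The kernel is strictly positive, so vanishing at one point would force `g = 0` a.e., against
  -- `h0`.
  have hpos : ∀ v, expSmoothing ε g v ≠ 0 := by
    intro v hv
    have hk := (measurable_expKernel ε).comp (measurable_prodMk_left (x := v))
    have h1 := (lintegral_eq_zero_iff (hk.mul hg)).1 hv
    refine h0 ?_
    rw [eLpNorm_eq_zero_iff hg.aestronglyMeasurable hθ0]
    filter_upwards [h1] with w hw
    rcases mul_eq_zero.1 hw with h | h
    · exact absurd (ENNReal.ofReal_eq_zero.1 h) (not_le.2 (Real.exp_pos _))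
    · exact h
  have hexp : ∀ v, ENNReal.ofReal (Real.exp (Real.log (expSmoothing ε g v).toReal))
      = expSmoothing ε g v := fun v => by
    rw [Real.exp_log (ENNReal.toReal_pos (hpos v) (hfin v)), ENNReal.ofReal_toReal (hfin v)]
  refine ⟨fun v => Real.log (expSmoothing ε g v).toReal, ?_, ?_, fun v => ?_⟩
  · have hone : ∀ v v', Real.log (expSmoothing ε g v).toReal
        - Real.log (expSmoothing ε g v').toReal ≤ ε * |v - v'| := by
      intro v v'
      have h1 := ENNReal.toReal_mono (ENNReal.mul_ne_top ENNReal.ofReal_ne_top (hfin v'))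
        (expSmoothing_le hε.le g v v')
      rw [ENNReal.toReal_mul, ENNReal.toReal_ofReal (Real.exp_pos _).le] at h1
      have h2 := Real.log_le_log (ENNReal.toReal_pos (hpos v) (hfin v)) h1
      rw [Real.log_mul (Real.exp_pos _).ne' (ENNReal.toReal_pos (hpos v') (hfin v')).ne',
        Real.log_exp] at h2
      linarith
    intro v v'
    rw [abs_le]
    refine ⟨?_, hone v v'⟩
    have := hone v' v
    rw [abs_sub_comm] at this
    linarith
  · simp_rw [hexp]
    exact hbound
  · rw [ENNReal.ofReal_mul zero_le_two, hexp, expSmoothing,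
      ← lintegral_const_mul' _ _ ENNReal.ofReal_ne_top]
    refine (setLIntegral_mono' measurableSet_Icc fun w hw => ?_).trans
      (setLIntegral_le_lintegral _ _)
    rw [← mul_assoc, ← ENNReal.ofReal_mul zero_le_two]
    refine le_mul_of_one_le_left zero_le ?_
    rw [← ENNReal.ofReal_one]
    refine ENNReal.ofReal_le_ofReal ?_
    have hl : 0 < Real.log 2 := Real.log_pos one_lt_two
    have h1 : |v - w| ≤ Real.log 2 := by
      rw [abs_le]
      constructor <;> linarith [hw.1, hw.2]
    -- As `ε ≤ 1`, the kernel is at least 1/2 on an interval of length `log 2`; this is the factor 2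
    -- in the conclusion.
    have h2 : Real.exp (-Real.log 2) ≤ Real.exp (-(ε * |v - w|)) := by
      refine Real.exp_le_exp.2 (neg_le_neg ?_)
      nlinarith [abs_nonneg (v - w)]
    rw [Real.exp_neg, Real.exp_log two_pos] at h2
    linarith

end Smoothing

/-! ### Balancing the step sizes along the axes. -/

section Balance

/-- Given slowly varying `ℓ_j`, one can distribute `u = ∑ v_j(u)` so that
`r_j (v_j(u) - β_j u) + ℓ_j(v_j(u))` does not depend on `j`. -/
theorem exists_balanced {n : ℕ} {r β w : Fin n → ℝ} {R κ ε : ℝ} (hr : ∀ j, 0 < r j)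
    (hβ : ∀ j, 0 ≤ β j) (hβ1 : ∑ j, β j = 1) (hw : ∀ j, 0 ≤ w j) (hw1 : ∑ j, w j = 1)
    (hR : R ≠ 0) (hwr : ∀ j, w j * r j = R) (hε : 0 ≤ ε) (hκ : κ ≤ 1 / 2)
    (hεκ : ∀ j, 2 * ε ≤ κ * r j) {ℓ : Fin n → ℝ → ℝ}
    (hℓ : ∀ j v v', |ℓ j v - ℓ j v'| ≤ ε * |v - v'|) :
    ∃ (v : ℝ → Fin n → ℝ) (L : ℝ → ℝ), (∀ u, L u = ∑ j, w j * ℓ j (v u j)) ∧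
      (∀ u, ∑ j, v u j = u) ∧ (∀ u j, r j * v u j + ℓ j (v u j) = r j * β j * u + L u) ∧
      (∀ u u', |L u - L u'| ≤ 2 * ε * |u - u'|) ∧
      (∀ u u' j, |v u j - v u' j - β j * (u - u')| ≤ 2 * κ * |u - u'|) := by
  have hβle : ∀ j, β j ≤ 1 := fun j => by
    rw [← hβ1]
    exact Finset.single_le_sum (fun i _ => hβ i) (Finset.mem_univ j)
  have hne : Nonempty (Fin n) := by
    by_contra h
    rw [not_nonempty_iff] at h
    simp at hw1
  have hκ0 : 0 ≤ κ := by
    obtain ⟨j⟩ := hne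
    by_contra h
    nlinarith [hεκ j, hr j]
  set m : (Fin n → ℝ) → ℝ := fun x => ∑ j, w j * ℓ j (x j) with hm
  have hmL : ∀ x y, |m x - m y| ≤ ε * dist x y := by
    intro x y
    rw [hm]
    simp only
    rw [← Finset.sum_sub_distrib]
    calc |∑ j, (w j * ℓ j (x j) - w j * ℓ j (y j))|
        ≤ ∑ j, |w j * ℓ j (x j) - w j * ℓ j (y j)| := Finset.abs_sum_le_sum_abs _ _
      _ ≤ ∑ j, w j * (ε * dist x y) := by
          refine Finset.sum_le_sum fun j _ => ?_
          rw [← mul_sub, abs_mul, abs_of_nonneg (hw j)]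
          refine mul_le_mul_of_nonneg_left ((hℓ j _ _).trans ?_) (hw j)
          exact mul_le_mul_of_nonneg_left (dist_le_pi_dist x y j) hε
      _ = ε * dist x y := by rw [← Finset.sum_mul, hw1, one_mul]
  have hdev : ∀ x y j, |(m x - ℓ j (x j)) / r j - (m y - ℓ j (y j)) / r j| ≤ κ * dist x y := by
    intro x y j
    rw [← sub_div, abs_div, abs_of_pos (hr j), div_le_iff₀ (hr j)]
    have h1 := hmL x y
    have h2 := (hℓ j (x j) (y j)).trans
      (mul_le_mul_of_nonneg_left (dist_le_pi_dist x y j) hε)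
    have h3 := abs_sub (m x - m y) (ℓ j (x j) - ℓ j (y j))
    have h4 : m x - ℓ j (x j) - (m y - ℓ j (y j)) = m x - m y - (ℓ j (x j) - ℓ j (y j)) := by ring
    rw [h4]
    have h5 := mul_le_mul_of_nonneg_right (hεκ j) (dist_nonneg (x := x) (y := y))
    linarith
  -- The balance equations with `L(u) = m(v)`, solved for `v_j`, are a fixed-point equation for `Φ
  -- u`. It is a `κ`-contraction because `m` and `ℓ j` are `ε`-Lipschitz and `2ε ≤ κ r_j`.
  set Φ : ℝ → (Fin n → ℝ) → (Fin n → ℝ) := fun u x j => β j * u + (m x - ℓ j (x j)) / r j with hΦ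
  have hcontr : ∀ u, ContractingWith κ.toNNReal (Φ u) := by
    intro u
    refine ⟨?_, LipschitzWith.of_dist_le_mul fun x y => ?_⟩
    · rw [Real.toNNReal_lt_one]
      linarith
    · rw [Real.coe_toNNReal κ hκ0, dist_pi_le_iff (by positivity)]
      intro j
      rw [Real.dist_eq, hΦ]
      simp only [add_sub_add_left_eq_sub]
      exact hdev x y j
  set v : ℝ → Fin n → ℝ := fun u => (hcontr u).fixedPoint with hv
  have hfix : ∀ u j, v u j = β j * u + (m (v u) - ℓ j (v u j)) / r j := fun u j =>
    (congrFun (hcontr u).fixedPoint_isFixedPt j).symm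
  have hdiff : ∀ u u' j, |v u j - v u' j - β j * (u - u')| ≤ κ * dist (v u) (v u') := by
    intro u u' j
    have : v u j - v u' j - β j * (u - u')
        = (m (v u) - ℓ j (v u j)) / r j - (m (v u') - ℓ j (v u' j)) / r j := by
      linear_combination hfix u j - hfix u' j
    rw [this]
    exact hdev _ _ j
  have hdist : ∀ u u', dist (v u) (v u') ≤ 2 * |u - u'| := by
    intro u u'
    have h1 : dist (v u) (v u') ≤ |u - u'| + κ * dist (v u) (v u') := by
      refine (dist_pi_le_iff (by positivity)).2 fun j => ?_
      rw [Real.dist_eq]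
      have h2 := hdiff u u' j
      have h3 : |β j * (u - u')| ≤ |u - u'| := by
        rw [abs_mul, abs_of_nonneg (hβ j)]
        exact mul_le_of_le_one_left (abs_nonneg _) (hβle j)
      have h4 := abs_add_le (v u j - v u' j - β j * (u - u')) (β j * (u - u'))
      rw [sub_add_cancel] at h4
      linarith
    nlinarith [dist_nonneg (x := v u) (y := v u')]
  refine ⟨v, fun u => m (v u), fun u => rfl, fun u => ?_, fun u j => ?_, fun u u' => ?_,
    fun u u' j => ?_⟩
  -- Since `1 / r_j = w_j / R` and `m` is the `w`-mean of the `ℓ_j`, the corrections cancel in the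
  -- sum.
  · have h1 : ∑ j, (m (v u) - ℓ j (v u j)) / r j = 0 := by
      have : ∀ j, (m (v u) - ℓ j (v u j)) / r j = (w j * m (v u) - w j * ℓ j (v u j)) / R := by
        intro j
        have hwj : w j ≠ 0 := fun h => hR (by rw [← hwr j, h, zero_mul])
        rw [← hwr j]
        field_simp [(hr j).ne']
      rw [Finset.sum_congr rfl fun j _ => this j, ← Finset.sum_div, Finset.sum_sub_distrib,
        ← Finset.sum_mul, hw1, one_mul, hm]
      simp
    rw [Finset.sum_congr rfl fun j _ => hfix u j, Finset.sum_add_distrib, h1, ← Finset.sum_mul,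
      hβ1, one_mul, add_zero]
  · have h1 := hfix u j
    have h2 : r j * ((m (v u) - ℓ j (v u j)) / r j) = m (v u) - ℓ j (v u j) :=
      mul_div_cancel₀ _ (hr j).ne'
    linear_combination r j * h1 + h2
  · have := hmL (v u) (v u')
    nlinarith [hdist u u']
  · have := hdiff u u' j
    nlinarith [hdist u u']

end Balance

/-! ### The commutative algebra of translations and its weak-type bounds. -/

section Shifts

variable {n : ℕ} {𝕜 : Type*} [RCLike 𝕜]

/-- Translations as a representation of `ℝⁿ` on functions. -/
def shiftHom (n : ℕ) (𝕜 : Type*) [RCLike 𝕜] :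
    Multiplicative (Fin n → ℝ) →* Module.End 𝕜 ((Fin n → ℝ) → 𝕜) where
  toFun z :=
    { toFun := fun f x => f (x + z.toAdd)
      map_add' := fun _ _ => rfl
      map_smul' := fun _ _ => rfl }
  map_one' := by
    ext f x
    simp
  map_mul' z z' := by
    ext f x
    simp [add_assoc]

/-- The action on functions of formal linear combinations of translations. -/
noncomputable def shiftAct (n : ℕ) (𝕜 : Type*) [RCLike 𝕜] :
    AddMonoidAlgebra 𝕜 (Fin n → ℝ) →ₐ[𝕜] Module.End 𝕜 ((Fin n → ℝ) → 𝕜) :=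
  AddMonoidAlgebra.lift 𝕜 _ _ (shiftHom n 𝕜)

theorem shiftAct_single (z : Fin n → ℝ) (c : 𝕜) (f : (Fin n → ℝ) → 𝕜) (x : Fin n → ℝ) :
    shiftAct n 𝕜 (AddMonoidAlgebra.single z c) f x = c * f (x + z) := by
  rw [shiftAct, AddMonoidAlgebra.lift_single]
  rfl

theorem shiftAct_mul (P Q : AddMonoidAlgebra 𝕜 (Fin n → ℝ)) (f : (Fin n → ℝ) → 𝕜) :
    shiftAct n 𝕜 (P * Q) f = shiftAct n 𝕜 P (shiftAct n 𝕜 Q f) := by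
  rw [map_mul]
  rfl

theorem shiftAct_sum_single {ι : Type*} (s : Finset ι) (z : ι → Fin n → ℝ) (c : ι → 𝕜)
    (f : (Fin n → ℝ) → 𝕜) (x : Fin n → ℝ) :
    shiftAct n 𝕜 (∑ i ∈ s, AddMonoidAlgebra.single (z i) (c i)) f x
      = ∑ i ∈ s, c i * f (x + z i) := by
  rw [map_sum, LinearMap.sum_apply, Finset.sum_apply]
  exact Finset.sum_congr rfl fun i _ => shiftAct_single _ _ _ _

/-- Coefficients of the averages `f - (-1)^k Δ^k(h) f`. -/
def shiftCoeff (𝕜 : Type*) [RCLike 𝕜] (k i : ℕ) : 𝕜 := (-1) ^ (i + 1) * (k.choose i : 𝕜)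

/-- The combination of translations `f ↦ f - (-1)^k Δ_j^k(s) f`. -/
noncomputable def axisMean (𝕜 : Type*) [RCLike 𝕜] (j : Fin n) (k : ℕ) (s : ℝ) :
    AddMonoidAlgebra 𝕜 (Fin n → ℝ) :=
  ∑ i ∈ Finset.Icc 1 k, AddMonoidAlgebra.single (Pi.single j ((i : ℝ) * s)) (shiftCoeff 𝕜 k i)

/-- The product of the `axisMean`s over all coordinates. -/
noncomputable def shiftMean (𝕜 : Type*) [RCLike 𝕜] (k : Fin n → ℕ) (h : Fin n → ℝ) :
    AddMonoidAlgebra 𝕜 (Fin n → ℝ) :=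
  ∏ j, axisMean 𝕜 j (k j) (h j)

theorem shiftAct_one_sub_axisMean (j : Fin n) (k : ℕ) (s : ℝ) (f : (Fin n → ℝ) → 𝕜) :
    shiftAct n 𝕜 (1 - axisMean 𝕜 j k s) f = (-1 : 𝕜) ^ k • difference j k s f := by
  ext x
  rw [map_sub, map_one, LinearMap.sub_apply, Pi.sub_apply, axisMean, shiftAct_sum_single,
    Pi.smul_apply, difference, smul_eq_mul, Finset.mul_sum, Finset.range_eq_Ico,
    Finset.sum_eq_sum_Ico_succ_bot (Nat.succ_pos k)]
  have hsq : ∀ i ≤ k, (-1 : 𝕜) ^ k * (-1) ^ (k - i) = (-1) ^ i := by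
    intro i hi
    obtain ⟨l, rfl⟩ := Nat.exists_eq_add_of_le hi
    rw [Nat.add_sub_cancel_left, pow_add, mul_assoc, ← pow_add, ← two_mul, pow_mul]
    simp
  have h0 := hsq 0 (Nat.zero_le k)
  rw [← mul_assoc, ← mul_assoc, h0]
  have hI : Finset.Ico (0 + 1) (k + 1) = Finset.Icc 1 k := by
    ext i
    simp
  simp only [Module.End.one_apply, pow_zero, Nat.choose_zero_right, Nat.cast_one, mul_one,
    one_mul, Nat.cast_zero, zero_mul, Pi.single_zero, add_zero]
  rw [sub_eq_add_neg, ← Finset.sum_neg_distrib, hI]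
  congr 1
  refine Finset.sum_congr rfl fun i hi => ?_
  rw [← mul_assoc, ← mul_assoc, hsq i (Finset.mem_Icc.1 hi).2, shiftCoeff]
  ring

theorem shiftAct_shiftMean (k : Fin n → ℕ) (h : Fin n → ℝ) (f : (Fin n → ℝ) → 𝕜)
    (x : Fin n → ℝ) :
    shiftAct n 𝕜 (shiftMean 𝕜 k h) f x =
      ∑ a ∈ Fintype.piFinset fun j => Finset.Icc 1 (k j),
        (∏ j, shiftCoeff 𝕜 (k j) (a j)) * f (x + (fun j => (a j : ℝ)) * h) := by
  rw [shiftMean]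
  simp only [axisMean]
  rw [Finset.prod_univ_sum]
  simp only [AddMonoidAlgebra.prod_single]
  rw [shiftAct_sum_single]
  refine Finset.sum_congr rfl fun a _ => ?_
  rw [Finset.univ_sum_single]
  rfl

theorem exists_lt_norm_of_sum {ι : Type*} {s : Finset ι} {c g : ι → 𝕜} {K l : ℝ}
    (hK : ∑ i ∈ s, ‖c i‖ ≤ K) (hl : 0 ≤ l) (h : K * l < ‖∑ i ∈ s, c i * g i‖) :
    ∃ i ∈ s, l < ‖g i‖ := by
  by_contra! hcon
  refine absurd h (not_lt.2 ?_)
  calc ‖∑ i ∈ s, c i * g i‖ ≤ ∑ i ∈ s, ‖c i‖ * l := by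
        refine norm_sum_le_of_le _ fun i hi => ?_
        rw [norm_mul]
        exact mul_le_mul_of_nonneg_left (hcon i hi) (norm_nonneg _)
    _ ≤ K * l := by
        rw [← Finset.sum_mul]
        exact mul_le_mul_of_nonneg_right hK hl

/-- Some translate must exceed `l`, and translations preserve measure. The one constant `K` bounds
both the coefficient sum and the number of translates. -/
theorem volume_shiftAct_sum_le {ι : Type*} (s : Finset ι) (z : ι → Fin n → ℝ) {c : ι → 𝕜} {K : ℕ}
    (hK : ∑ i ∈ s, ‖c i‖ ≤ K) (hs : s.card ≤ K) (g : (Fin n → ℝ) → 𝕜) {l : ℝ} (hl : 0 ≤ l) :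
    volume {x | K * l < ‖shiftAct n 𝕜 (∑ i ∈ s, AddMonoidAlgebra.single (z i) (c i)) g x‖}
      ≤ K * volume {x | l < ‖g x‖} := by
  have hsub : {x | K * l < ‖shiftAct n 𝕜 (∑ i ∈ s, AddMonoidAlgebra.single (z i) (c i)) g x‖}
      ⊆ ⋃ i ∈ s, (fun x => x + z i) ⁻¹' {x | l < ‖g x‖} := by
    intro x hx
    rw [mem_ofPred_eq, shiftAct_sum_single] at hx
    obtain ⟨i, hi, h⟩ := exists_lt_norm_of_sum hK hl hx
    exact mem_biUnion hi h
  refine (measure_mono hsub).trans ((measure_biUnion_finset_le _ _).trans ?_)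
  simp only [measure_preimage_add_right, Finset.sum_const, nsmul_eq_mul]
  gcongr

theorem norm_shiftCoeff (k i : ℕ) : ‖shiftCoeff 𝕜 k i‖ = k.choose i := by
  simp [shiftCoeff]

theorem exists_volume_prod_axisMean_le (k : Fin n → ℕ) (J : Finset (Fin n)) :
    ∃ K : ℕ, ∀ (h : Fin n → ℝ) (g : (Fin n → ℝ) → 𝕜) (l : ℝ), 0 ≤ l →
      volume {x | K * l < ‖shiftAct n 𝕜 (∏ j ∈ J, axisMean 𝕜 j (k j) (h j)) g x‖}
        ≤ K * volume {x | l < ‖g x‖} := by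
  classical
  induction J using Finset.induction_on with
  | empty =>
    refine ⟨1, fun h g l hl => ?_⟩
    simp
  | insert j J hj ih =>
    obtain ⟨K, hK⟩ := ih
    set N : ℕ := (∑ i ∈ Finset.Icc 1 (k j), (k j).choose i) + (Finset.Icc 1 (k j)).card with hN
    refine ⟨N * K, fun h g l hl => ?_⟩
    rw [Finset.prod_insert hj, shiftAct_mul]
    have h1 := volume_shiftAct_sum_le (Finset.Icc 1 (k j))
      (fun i => (Pi.single j ((i : ℝ) * h j) : Fin n → ℝ)) (c := shiftCoeff 𝕜 (k j)) (K := N)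
      (by simp only [norm_shiftCoeff]; rw [hN]; exact_mod_cast Nat.le_add_right _ _)
      (Nat.le_add_left _ _)
      (shiftAct n 𝕜 (∏ j ∈ J, axisMean 𝕜 j (k j) (h j)) g) (mul_nonneg (Nat.cast_nonneg K) hl)
    rw [Nat.cast_mul, Nat.cast_mul, mul_assoc, mul_assoc]
    exact h1.trans (mul_le_mul_right (hK h g l hl) _)

/-- Telescoping `1 - AP = P(1 - A) + (1 - P)`, where `1 - A` is a difference up to sign and `P`
obeys a weak-type bound uniform in the steps. -/
theorem exists_volume_one_sub_prod_axisMean_le (k : Fin n → ℕ) (J : Finset (Fin n)) :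
    ∃ K : ℕ, ∀ (h : Fin n → ℝ) (f : (Fin n → ℝ) → 𝕜) (l : ℝ), 0 ≤ l →
      volume {x | K * l < ‖shiftAct n 𝕜 (1 - ∏ j ∈ J, axisMean 𝕜 j (k j) (h j)) f x‖}
        ≤ K * ∑ j ∈ J, volume {x | l < ‖difference j (k j) (h j) f x‖} := by
  classical
  induction J using Finset.induction_on with
  | empty =>
    refine ⟨0, fun h f l hl => ?_⟩
    simp
  | insert j J hj ih =>
    obtain ⟨K, hK⟩ := ih
    obtain ⟨M, hM⟩ := exists_volume_prod_axisMean_le (𝕜 := 𝕜) k J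
    refine ⟨M + K, fun h f l hl => ?_⟩
    set P := ∏ j ∈ J, axisMean 𝕜 j (k j) (h j) with hP
    have hsplit : (1 : AddMonoidAlgebra 𝕜 (Fin n → ℝ))
        - ∏ j ∈ insert j J, axisMean 𝕜 j (k j) (h j)
        = P * (1 - axisMean 𝕜 j (k j) (h j)) + (1 - P) := by
      rw [Finset.prod_insert hj]
      ring
    have hsub : {x | ((M + K : ℕ) : ℝ) * l < ‖shiftAct n 𝕜
          (1 - ∏ j ∈ insert j J, axisMean 𝕜 j (k j) (h j)) f x‖}
        ⊆ {x | M * l < ‖shiftAct n 𝕜 P ((-1 : 𝕜) ^ (k j) • difference j (k j) (h j) f) x‖}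
          ∪ {x | K * l < ‖shiftAct n 𝕜 (1 - P) f x‖} := by
      intro x hx
      rw [mem_ofPred_eq, hsplit, map_add, LinearMap.add_apply, Pi.add_apply, shiftAct_mul,
        shiftAct_one_sub_axisMean] at hx
      by_contra hcon
      simp only [mem_union, mem_ofPred_eq, not_or, not_lt] at hcon
      refine absurd (hx.trans_le (norm_add_le _ _)) (not_lt.2 ?_)
      push_cast
      linarith [hcon.1, hcon.2]
    refine (measure_mono hsub).trans ((measure_union_le _ _).trans ?_)
    have h1 := hM h ((-1 : 𝕜) ^ (k j) • difference j (k j) (h j) f) l hl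
    have hnorm : ∀ x, ‖((-1 : 𝕜) ^ (k j) • difference j (k j) (h j) f) x‖
        = ‖difference j (k j) (h j) f x‖ := fun x => by
      rw [Pi.smul_apply, norm_smul, norm_pow, norm_neg, norm_one, one_pow, one_mul]
    simp only [hnorm] at h1
    rw [Finset.sum_insert hj, Nat.cast_add]
    refine (add_le_add h1 (hK h f l hl)).trans ?_
    rw [add_mul, mul_add, mul_add]
    exact add_le_add le_self_add le_add_self

/-- The weak-type bound for averages of shifts along a multi-step. -/
theorem exists_volume_shiftMean_le (k : Fin n → ℕ) :
    ∃ K : ℕ, 1 ≤ K ∧ ∀ g : (Fin n → ℝ) → 𝕜, Measurable g → ∀ (x : Fin n → ℝ) (l : ℝ), 0 ≤ l →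
      volume {h | K * l < ‖shiftAct n 𝕜 (shiftMean 𝕜 k h) g x‖}
        ≤ K * volume {x | l < ‖g x‖} := by
  set S := Fintype.piFinset fun j => Finset.Icc 1 (k j) with hS
  refine ⟨1 + ∑ a ∈ S, ∏ j, (k j).choose (a j) + S.card, by omega, fun g hg x l hl => ?_⟩
  set K := 1 + ∑ a ∈ S, ∏ j, (k j).choose (a j) + S.card with hK
  have hsub : {h | K * l < ‖shiftAct n 𝕜 (shiftMean 𝕜 k h) g x‖}
      ⊆ ⋃ a ∈ S, {h | x + (fun j => (a j : ℝ)) * h ∈ {y | l < ‖g y‖}} := by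
    intro h hh
    rw [mem_ofPred_eq, shiftAct_shiftMean] at hh
    have hnorm : ∑ a ∈ S, ‖∏ j, shiftCoeff 𝕜 (k j) (a j)‖ ≤ K := by
      simp only [norm_prod, norm_shiftCoeff]
      rw [hK]
      push_cast
      have : (0 : ℝ) ≤ S.card := Nat.cast_nonneg _
      linarith
    obtain ⟨a, ha, hl'⟩ := exists_lt_norm_of_sum hnorm hl hh
    exact mem_biUnion ha hl'
  refine (measure_mono hsub).trans ((measure_biUnion_finset_le _ _).trans ?_)
  calc ∑ a ∈ S, volume {h | x + (fun j => (a j : ℝ)) * h ∈ {y | l < ‖g y‖}}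
      ≤ ∑ a ∈ S, volume {y | l < ‖g y‖} := by
        refine Finset.sum_le_sum fun a ha => ?_
        -- The zero shift is absent from `axisMean`, so every multiplier `a i` is at least 1 and the
        -- bound in the step variable applies.
        refine volume_preimage_add_mul_le x (fun i => ?_) (measurableSet_lt measurable_const hg.norm)
        exact_mod_cast (Finset.mem_Icc.1 (Fintype.mem_piFinset.1 ha i)).1
    _ ≤ K * volume {y | l < ‖g y‖} := by
        rw [Finset.sum_const, nsmul_eq_mul]
        gcongr
        exact Nat.le_add_left _ _

theorem measurable_shiftAct_shiftMean {α : Type*} [MeasurableSpace α] (k : Fin n → ℕ)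
    {η ξ : α → Fin n → ℝ} (hη : Measurable η) (hξ : Measurable ξ)
    {F : α → (Fin n → ℝ) → 𝕜} (hF : Measurable (Function.uncurry F)) :
    Measurable fun q => shiftAct n 𝕜 (shiftMean 𝕜 k (η q)) (F q) (ξ q) := by
  simp only [shiftAct_shiftMean]
  refine Finset.measurable_sum _ fun a _ => Measurable.const_mul ?_ _
  have : Measurable fun q => (q, ξ q + (fun j => (a j : ℝ)) * η q) := by fun_prop
  exact hF.comp this

theorem shiftAct_one_sub (P : AddMonoidAlgebra 𝕜 (Fin n → ℝ)) (f : (Fin n → ℝ) → 𝕜)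
    (x : Fin n → ℝ) : shiftAct n 𝕜 (1 - P) f x = f x - shiftAct n 𝕜 P f x := by
  rw [map_sub, map_one, LinearMap.sub_apply, Pi.sub_apply]
  rfl

theorem measurable_shiftAct_one_sub_shiftMean {α : Type*} [MeasurableSpace α] (k : Fin n → ℕ)
    {f : (Fin n → ℝ) → 𝕜} (hf : Measurable f)
    {η ξ : α → Fin n → ℝ} (hη : Measurable η) (hξ : Measurable ξ) :
    Measurable fun q => shiftAct n 𝕜 (1 - shiftMean 𝕜 k (η q)) f (ξ q) := by
  simp only [shiftAct_one_sub]
  exact (hf.comp hξ).sub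
    (measurable_shiftAct_shiftMean k hη hξ (F := fun _ => f) (hf.comp measurable_snd))

/-- Commutativity of translations. It compares two averages through the two errors `f - Qf` and `f -
Pf` only. -/
theorem shiftAct_sub_shiftAct (P Q : AddMonoidAlgebra 𝕜 (Fin n → ℝ)) (f : (Fin n → ℝ) → 𝕜)
    (x : Fin n → ℝ) :
    shiftAct n 𝕜 P f x - shiftAct n 𝕜 Q f x =
      shiftAct n 𝕜 P (shiftAct n 𝕜 (1 - Q) f) x - shiftAct n 𝕜 Q (shiftAct n 𝕜 (1 - P) f) x := by
  have hsub : ∀ A B : AddMonoidAlgebra 𝕜 (Fin n → ℝ),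
      shiftAct n 𝕜 (A - B) f x = shiftAct n 𝕜 A f x - shiftAct n 𝕜 B f x := fun A B => by
    rw [map_sub, LinearMap.sub_apply, Pi.sub_apply]
  have h : P - Q = P * (1 - Q) - Q * (1 - P) := by ring
  rw [← hsub, h, hsub, shiftAct_mul, shiftAct_mul]

end Shifts

/-! ### Linking scales and bounding a level of `f`. -/

section WeakEstimate

/-- If, for most pairs, one of two relations fails rarely in each section, then points `y` failing
to be linked to a large set `H` are rare. -/
theorem measure_unlinked_le {α β : Type*} [MeasurableSpace α] [MeasurableSpace β]
    {μ : Measure α} {ν : Measure β} [SFinite μ] [SFinite ν] {Q : Set (α × β)}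
    (hQ : MeasurableSet Q) {P : Set (α × β)} {G H : Set α} {G' B : Set β}
    (hH : MeasurableSet H) (hB : MeasurableSet B) (hHG : H ⊆ G) (hBG : B ⊆ G')
    (hG : μ G ≠ ∞) (hG0 : μ G ≠ 0) (hGH : μ G ≤ 2 * μ H)
    (hP : ∀ y ∈ G', 8 * μ {x ∈ G | (x, y) ∈ P} ≤ μ G)
    (hQ' : ∀ x ∈ G, 8 * ν {y ∈ G' | (x, y) ∈ Q} ≤ ν G')
    (hPQ : ∀ y ∈ B, ∀ x ∈ H, (x, y) ∈ P ∨ (x, y) ∈ Q) :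
    2 * ν B ≤ ν G' := by
  have hHt : μ H ≠ ∞ := ne_top_of_le_ne_top hG (measure_mono hHG)
  -- `H` fills at least 1/2 of `G` and `P` accounts for at most 1/8, leaving at least 3/8 for `Q`;
  -- 1/4 suffices.
  have h1 : ∀ y ∈ B, μ G / 4 ≤ μ {x ∈ H | (x, y) ∈ Q} := by
    intro y hy
    have hsub : H ⊆ {x ∈ G | (x, y) ∈ P} ∪ {x ∈ H | (x, y) ∈ Q} := by
      intro x hx
      rcases hPQ y hy x hx with h | h
      · exact Or.inl ⟨hHG hx, h⟩
      · exact Or.inr ⟨hx, h⟩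
    have h2 := (measure_mono hsub).trans (measure_union_le (μ := μ) _ _)
    have h3 := hP y (hBG hy)
    have e1 : μ {x ∈ G | (x, y) ∈ P} ≠ ∞ :=
      ne_top_of_le_ne_top hG (measure_mono fun x hx => hx.1)
    have e2 : μ {x ∈ H | (x, y) ∈ Q} ≠ ∞ :=
      ne_top_of_le_ne_top hHt (measure_mono fun x hx => hx.1)
    rw [ENNReal.div_le_iff_le_mul (Or.inl (by norm_num)) (Or.inl (by norm_num))]
    lift μ G to ℝ≥0 using hG with a
    lift μ H to ℝ≥0 using hHt with b
    lift μ {x ∈ G | (x, y) ∈ P} to ℝ≥0 using e1 with c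
    lift μ {x ∈ H | (x, y) ∈ Q} to ℝ≥0 using e2 with d
    norm_cast at *
    rw [← NNReal.coe_le_coe] at *
    push_cast at *
    linarith [c.coe_nonneg]
  have h2 : ∀ x ∈ H, ν {y ∈ B | (x, y) ∈ Q} ≤ ν G' / 8 := by
    intro x hx
    rw [ENNReal.le_div_iff_mul_le (Or.inl (by norm_num)) (Or.inl (by norm_num)), mul_comm]
    refine le_trans ?_ (hQ' x (hHG hx))
    gcongr
  have hswap : MeasurableSet (Prod.swap ⁻¹' Q : Set (β × α)) := measurable_swap hQ
  -- Double counting gives `(μ G / 4) ν B ≤ (ν G' / 8) μ H`; bounding `μ H` by `μ G` and cancelling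
  -- it gives the claim.
  have h3 := mul_measure_le_of_sections (μ := ν) (ν := μ) hswap hB hH h1 h2
  have h4 : ν G' / 8 * μ H ≤ ν G' / 8 * μ G := by gcongr
  have h5 := h3.trans h4
  have e8 : ν G' / 8 = (ν G' / 2) / 4 := by
    rw [ENNReal.div_eq_inv_mul, ENNReal.div_eq_inv_mul, ENNReal.div_eq_inv_mul, ← mul_assoc,
      ← ENNReal.mul_inv (by norm_num) (by norm_num)]
    norm_num
  rw [e8, ENNReal.div_eq_inv_mul, ENNReal.div_eq_inv_mul (a := ν G' / 2), mul_assoc, mul_assoc,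
    mul_comm (ν G' / 2)] at h5
  have h6 : ν B ≤ ν G' / 2 := by
    rw [ENNReal.mul_le_mul_iff_right (by norm_num) (by norm_num),
      ENNReal.mul_le_mul_iff_right hG0 hG] at h5
    exact h5
  rw [mul_comm]
  rwa [ENNReal.le_div_iff_mul_le (Or.inl (by norm_num)) (Or.inl (by norm_num))] at h6

variable {n : ℕ} {𝕜 : Type*} [RCLike 𝕜]

/-- A chain of scales: if at each scale `2^m t` there is a large set of steps whose averages
approximate `f` up to `l m` outside a small set, then `|f|` exceeds `C ∑ l m` only on a set of
measure less than `t`. -/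
theorem level_le_of_chain {f : (Fin n → ℝ) → 𝕜} (hf : Measurable f)
    (hS : ∀ y : ℝ, 0 < y → volume {x | y < ‖f x‖} ≠ ∞) {k : Fin n → ℕ} {K : ℕ} (hK1 : 1 ≤ K)
    (hK : ∀ g : (Fin n → ℝ) → 𝕜, Measurable g → ∀ (x : Fin n → ℝ) (l : ℝ), 0 ≤ l →
      volume {h | K * l < ‖shiftAct n 𝕜 (shiftMean 𝕜 k h) g x‖} ≤ K * volume {x | l < ‖g x‖})
    {t γ : ℝ} (ht : 0 < t) (hγ : 0 < γ) (hγ1 : γ ≤ 1) {G : ℕ → Set (Fin n → ℝ)}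
    (hGm : ∀ m, MeasurableSet (G m)) (hGt : ∀ m, volume (G m) ≠ ∞)
    (hG : ∀ m, ENNReal.ofReal (γ * (2 ^ m * t)) ≤ volume (G m))
    {l : ℕ → ℝ} (hl : ∀ m, 0 ≤ l m)
    (hGl : ∀ m, ∀ h ∈ G m, volume {x | l m < ‖shiftAct n 𝕜 (1 - shiftMean 𝕜 k h) f x‖}
      ≤ ENNReal.ofReal (γ / (16 * K) * (2 ^ m * t)))
    {R : ℝ} (hR : ∀ M, (1 + 2 * K) * ∑ m ∈ Finset.range M, l m ≤ R) {y : ℝ}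
    (hy : ENNReal.ofReal t ≤ volume {x | y < ‖f x‖}) : y ≤ R := by
  have hKpos : (0 : ℝ) < K := by exact_mod_cast hK1
  have hG0 : ∀ m, volume (G m) ≠ 0 := fun m => by
    refine (lt_of_lt_of_le ?_ (hG m)).ne'
    rw [ENNReal.ofReal_pos]
    positivity
  have hKmul : ∀ a : ℝ, (K : ℝ≥0∞) * ENNReal.ofReal a = ENNReal.ofReal (K * a) := fun a => by
    rw [ENNReal.ofReal_mul hKpos.le, ENNReal.ofReal_natCast]
  have h8mul : ∀ a : ℝ, 8 * ENNReal.ofReal a = ENNReal.ofReal (8 * a) := fun a => by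
    rw [ENNReal.ofReal_mul (by norm_num)]
    norm_num
  -- the starting point
  obtain ⟨x, hxy, hx⟩ : ∃ x, y < ‖f x‖ ∧
      2 * volume {h ∈ G 0 | l 0 < ‖shiftAct n 𝕜 (1 - shiftMean 𝕜 k h) f x‖} ≤ volume (G 0) := by
    -- Otherwise each point of `{y < ‖f‖}` has bad steps filling more than half of `G 0`, and double
    -- counting gives `t / 2 ≤ γ / (16 K) * t`, impossible as `γ / (16 K) ≤ 1/16`.
    by_contra! hcon
    set P : Set ((Fin n → ℝ) × (Fin n → ℝ)) :=
      {q | l 0 < ‖shiftAct n 𝕜 (1 - shiftMean 𝕜 k q.2) f q.1‖} with hP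
    have hPm : MeasurableSet P := measurableSet_lt measurable_const
      (measurable_shiftAct_one_sub_shiftMean k hf measurable_snd measurable_fst).norm
    have h := mul_measure_le_of_sections (μ := volume) (ν := volume) hPm
      (s := {x | y < ‖f x‖}) (t := G 0) (measurableSet_lt measurable_const hf.norm) (hGm 0)
      (a := volume (G 0) / 2) (b := ENNReal.ofReal (γ / (16 * K) * (2 ^ 0 * t)))
      (fun x hx => by
        rw [ENNReal.div_le_iff_le_mul (Or.inl (by norm_num)) (Or.inl (by norm_num)), mul_comm]
        exact (hcon x hx).le)
      (fun h hh => (measure_mono fun x hx => hx.2).trans (hGl 0 h hh))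
    have h2 := (mul_le_mul_right hy (volume (G 0) / 2)).trans h
    rw [mul_comm, ENNReal.div_eq_inv_mul, ← mul_assoc,
      ENNReal.mul_le_mul_iff_left (hG0 0) (hGt 0), mul_comm, ← ENNReal.div_eq_inv_mul,
      ENNReal.div_le_iff_le_mul (Or.inl (by norm_num)) (Or.inl (by norm_num)),
      ← ENNReal.ofReal_ofNat 2, ← ENNReal.ofReal_mul (by positivity),
      ENNReal.ofReal_le_ofReal_iff (by positivity)] at h2
    have h3 : γ / (16 * K) ≤ 1 / 16 := by
      rw [div_le_div_iff₀ (by positivity) (by norm_num)]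
      have : (1 : ℝ) ≤ K := by exact_mod_cast hK1
      linarith
    nlinarith
  -- `L M` is the error accumulated at the fixed `x` up to scale `M`. The induction shows that the
  -- steps in `G m` respecting it, the set `H m`, fill at least half of `G m`.
  set L : ℕ → ℝ := fun M => l 0 + ∑ m ∈ Finset.range M, K * (l m + l (m + 1)) with hL
  set H : ℕ → Set (Fin n → ℝ) := fun m =>
    {h ∈ G m | ‖f x - shiftAct n 𝕜 (shiftMean 𝕜 k h) f x‖ ≤ L m} with hH
  have hHm : ∀ m, MeasurableSet (H m) := fun m => (hGm m).inter <| measurableSet_le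
    (measurable_const.sub (measurable_shiftAct_shiftMean k measurable_id measurable_const
      (F := fun _ => f) (hf.comp measurable_snd))).norm measurable_const
  have hfin : ∀ m, ∀ s ⊆ G m, volume s ≠ ∞ := fun m s hs =>
    ne_top_of_le_ne_top (hGt m) (measure_mono hs)
  have hcompl : ∀ m, 2 * volume (G m \ H m) ≤ volume (G m) → volume (G m) ≤ 2 * volume (H m) := by
    intro m hm
    have hHG : H m ⊆ G m := fun h hh => hh.1
    have e := measure_sdiff_add_inter (μ := volume) (G m) (hHm m)
    rw [inter_eq_self_of_subset_right hHG] at e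
    have e1 := hfin m (G m \ H m) sdiff_subset
    have e2 := hfin m (H m) hHG
    have e3 := hGt m
    lift volume (G m) to ℝ≥0 using e3 with a
    lift volume (H m) to ℝ≥0 using e2 with b
    lift volume (G m \ H m) to ℝ≥0 using e1 with c
    norm_cast at *
    rw [← NNReal.coe_le_coe] at *
    rw [← NNReal.coe_inj] at e
    push_cast at *
    linarith
  have hchain : ∀ m, volume (G m) ≤ 2 * volume (H m) := by
    intro m
    induction m with
    | zero =>
      refine hcompl 0 (le_trans ?_ hx)
      gcongr
      rintro h ⟨hh, hh'⟩
      refine ⟨hh, ?_⟩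
      rw [shiftAct_one_sub]
      by_contra hcon
      refine hh' ⟨hh, (not_lt.1 hcon).trans ?_⟩
      simp [hL]
    | succ m ih =>
      refine hcompl (m + 1) ?_
      set P : Set ((Fin n → ℝ) × (Fin n → ℝ)) := {q | K * l (m + 1) <
        ‖shiftAct n 𝕜 (shiftMean 𝕜 k q.1) (shiftAct n 𝕜 (1 - shiftMean 𝕜 k q.2) f) x‖} with hP
      set Q : Set ((Fin n → ℝ) × (Fin n → ℝ)) := {q | K * l m <
        ‖shiftAct n 𝕜 (shiftMean 𝕜 k q.2) (shiftAct n 𝕜 (1 - shiftMean 𝕜 k q.1) f) x‖} with hQ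
      have hQm : MeasurableSet Q := measurableSet_lt measurable_const
        (measurable_shiftAct_shiftMean k measurable_snd measurable_const
          (F := fun q : (Fin n → ℝ) × (Fin n → ℝ) => shiftAct n 𝕜 (1 - shiftMean 𝕜 k q.1) f)
          (measurable_shiftAct_one_sub_shiftMean k hf (measurable_fst.comp measurable_fst)
            measurable_snd)).norm
      have hDm : ∀ h, Measurable (shiftAct n 𝕜 (1 - shiftMean 𝕜 k h) f) := fun h =>
        measurable_shiftAct_one_sub_shiftMean k hf measurable_const measurable_id
      -- This step explains the `16 K` in `hGl`: `K` is lost in the weak-type bound in the step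
      -- variable, 8 in the linking lemma, and 2 because the error set at scale `m + 1` is compared
      -- with `G m`.
      refine measure_unlinked_le (μ := volume) (ν := volume) hQm (P := P) (hHm m)
        ((hGm _).diff (hHm _)) (fun h hh => hh.1) sdiff_subset (hGt m) (hG0 m) ih ?_ ?_ ?_
      · intro h' hh'
        have h1 : volume {h ∈ G m | (h, h') ∈ P}
            ≤ ENNReal.ofReal (K * (γ / (16 * K) * (2 ^ (m + 1) * t))) := by
          rw [← hKmul]
          refine ((measure_mono fun h hh => hh.2).trans
            (hK _ (hDm h') x _ (hl (m + 1)))).trans ?_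
          gcongr
          exact hGl _ _ hh'
        refine le_trans (mul_le_mul_right h1 8) (le_trans (le_of_eq ?_) (hG m))
        rw [h8mul]
        congr 1
        field_simp
        ring
      · intro h hh
        have h1 : volume {h' ∈ G (m + 1) | (h, h') ∈ Q}
            ≤ ENNReal.ofReal (K * (γ / (16 * K) * (2 ^ m * t))) := by
          rw [← hKmul]
          refine ((measure_mono fun h hh => hh.2).trans (hK _ (hDm h) x _ (hl m))).trans ?_
          gcongr
          exact hGl _ _ hh
        refine le_trans (mul_le_mul_right h1 8) (le_trans ?_ (hG (m + 1)))
        rw [h8mul]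
        refine ENNReal.ofReal_le_ofReal ?_
        have e : 8 * (K * (γ / (16 * K) * (2 ^ m * t))) = γ * (2 ^ m * t) / 2 := by
          field_simp
          ring
        rw [e, pow_succ]
        have : 0 < γ * (2 ^ m * t) := by positivity
        linarith
      · rintro h' ⟨hh', hnot⟩ h ⟨hh, hle⟩
        by_contra hcon
        simp only [hP, hQ, mem_ofPred_eq, not_or, not_lt] at hcon
        refine hnot ⟨hh', ?_⟩
        have e := shiftAct_sub_shiftAct (shiftMean 𝕜 k h) (shiftMean 𝕜 k h') f x
        have h3 := norm_add_le (f x - shiftAct n 𝕜 (shiftMean 𝕜 k h) f x)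
          (shiftAct n 𝕜 (shiftMean 𝕜 k h) f x - shiftAct n 𝕜 (shiftMean 𝕜 k h') f x)
        rw [sub_add_sub_cancel] at h3
        have h4 := norm_sub_le
          (shiftAct n 𝕜 (shiftMean 𝕜 k h) (shiftAct n 𝕜 (1 - shiftMean 𝕜 k h') f) x)
          (shiftAct n 𝕜 (shiftMean 𝕜 k h') (shiftAct n 𝕜 (1 - shiftMean 𝕜 k h) f) x)
        rw [← e] at h4
        have h5 : L (m + 1) = L m + K * (l m + l (m + 1)) := by
          rw [hL]
          simp only [Finset.sum_range_succ]
          ring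
        rw [h5]
        linarith [hcon.1, hcon.2]
  -- Each `l m` enters `L M` at most twice with weight `K`, and `l 0` once more, whence the factor
  -- `1 + 2 * K`.
  have hLR : ∀ M, L M ≤ R := by
    intro M
    refine le_trans ?_ (hR (M + 1))
    rw [hL]
    simp only
    rw [← Finset.mul_sum, Finset.sum_add_distrib]
    have h1 : ∑ m ∈ Finset.range M, l m ≤ ∑ m ∈ Finset.range (M + 1), l m := by
      rw [Finset.sum_range_succ]
      linarith [hl M]
    have h2 : ∑ m ∈ Finset.range M, l (m + 1) + l 0 = ∑ m ∈ Finset.range (M + 1), l m :=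
      (Finset.sum_range_succ' l M).symm
    have h3 : (0 : ℝ) ≤ ∑ m ∈ Finset.range M, l (m + 1) := Finset.sum_nonneg fun m _ => hl _
    have h5 := mul_le_mul_of_nonneg_left (add_le_add h1
      (show ∑ m ∈ Finset.range M, l (m + 1) ≤ ∑ m ∈ Finset.range (M + 1), l m by
        linarith [hl 0])) hKpos.le
    linarith
  refine hxy.le.trans (le_of_forall_pos_le_add fun δ hδ => ?_)
  set d : ℝ := δ / K with hd
  have hdpos : 0 < d := by positivity
  have hdt := hS d hdpos
  -- At a large enough scale `H M` is bigger than the set of steps with `‖S_h f(x)‖ > K d = δ`. A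
  -- step of `H M` outside that set gives `‖f x‖ ≤ L M + δ`.
  obtain ⟨M, hM⟩ : ∃ M : ℕ, (K * (volume {x | d < ‖f x‖}).toReal) * 2 < γ * (2 ^ M * t) := by
    obtain ⟨M, hM⟩ := pow_unbounded_of_one_lt
      ((K * (volume {x | d < ‖f x‖}).toReal) * 2 / (γ * t)) one_lt_two
    refine ⟨M, ?_⟩
    rw [div_lt_iff₀ (by positivity)] at hM
    linarith
  have hlt : volume {h | K * d < ‖shiftAct n 𝕜 (shiftMean 𝕜 k h) f x‖} < volume (H M) := by
    refine (hK f hf x d hdpos.le).trans_lt ?_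
    rw [← ENNReal.mul_lt_mul_iff_right (a := 2) (by norm_num) (by norm_num)]
    refine lt_of_lt_of_le ?_ ((hG M).trans (hchain M))
    rw [← ENNReal.ofReal_toReal hdt, hKmul, ← ENNReal.ofReal_ofNat 2,
      ← ENNReal.ofReal_mul (by positivity), ENNReal.ofReal_lt_ofReal_iff (by positivity)]
    linarith
  obtain ⟨h, hhH, hh⟩ : ∃ h ∈ H M, ‖shiftAct n 𝕜 (shiftMean 𝕜 k h) f x‖ ≤ K * d := by
    by_contra! hcon
    exact absurd hlt (not_lt.2 (measure_mono hcon))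
  have h1 := norm_add_le (f x - shiftAct n 𝕜 (shiftMean 𝕜 k h) f x)
    (shiftAct n 𝕜 (shiftMean 𝕜 k h) f x)
  rw [sub_add_cancel] at h1
  have h2 : K * d = δ := mul_div_cancel₀ _ hKpos.ne'
  linarith [hLR M, hhH.2]

end WeakEstimate

/-! ### Measurability, vanishing seminorms and good steps. -/

section Differences

variable {n : ℕ} {𝕜 : Type*} [RCLike 𝕜]

theorem measurable_difference {α : Type*} [MeasurableSpace α] (j : Fin n) (k : ℕ)
    {f : (Fin n → ℝ) → 𝕜} (hf : Measurable f) {s : α → ℝ} (hs : Measurable s)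
    {ξ : α → Fin n → ℝ} (hξ : Measurable ξ) : Measurable fun q => difference j k (s q) f (ξ q) := by
  classical
  simp only [difference]
  refine Finset.measurable_sum _ fun i _ => Measurable.const_mul ?_ _
  refine hf.comp (hξ.add ?_)
  rw [measurable_pi_iff]
  intro a
  by_cases h : a = j
  · subst h
    simpa using hs.const_mul _
  · simp [h]

theorem measurable_eLpNorm_difference (j : Fin n) (k : ℕ) {f : (Fin n → ℝ) → 𝕜}
    (hf : Measurable f) {p : ℝ} (hp : 0 < p) :
    Measurable fun s => eLpNorm (difference j k s f) (ENNReal.ofReal p) volume := by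
  have h : ∀ s, eLpNorm (difference j k s f) (ENNReal.ofReal p) volume
      = (∫⁻ x, ‖difference j k s f x‖ₑ ^ p) ^ (1 / p) := fun s => by
    rw [eLpNorm_eq_lintegral_rpow_enorm_toReal (by simpa using hp) ENNReal.ofReal_ne_top,
      ENNReal.toReal_ofReal hp.le]
  simp only [h]
  refine Measurable.pow_const (Measurable.lintegral_prod_right' (f := fun q : ℝ × (Fin n → ℝ) =>
    ‖difference j k q.1 f q.2‖ₑ ^ p) ?_) _
  exact ((measurable_difference j k hf measurable_fst measurable_snd).enorm).pow_const _

theorem difference_congr_ae (j : Fin n) (k : ℕ) (s : ℝ) {f g : (Fin n → ℝ) → 𝕜}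
    (h : f =ᵐ[volume] g) : difference j k s f =ᵐ[volume] difference j k s g := by
  have h1 : ∀ i : ℕ, ∀ᵐ x : Fin n → ℝ,
      f (x + Pi.single j ((i : ℝ) * s)) = g (x + Pi.single j ((i : ℝ) * s)) := fun i => (measurePreserving_add_right volume
      (Pi.single j ((i : ℝ) * s) : Fin n → ℝ)).quasiMeasurePreserving.ae h
  filter_upwards [ae_all_iff.2 h1] with x hx
  simp [difference, hx]

theorem besovSeminorm_congr_ae (j : Fin n) (k : ℕ) (r p : ℝ) (θ : ℝ≥0∞) {f g : (Fin n → ℝ) → 𝕜}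
    (h : f =ᵐ[volume] g) : besovSeminorm j k r p θ f = besovSeminorm j k r p θ g := by
  simp only [besovSeminorm, eLpNorm_congr_ae (difference_congr_ae j k _ h)]

theorem distribution_congr_ae {f g : (Fin n → ℝ) → 𝕜} (h : f =ᵐ[volume] g) :
    distribution f = distribution g := by
  ext y
  refine measure_congr ?_
  filter_upwards [h] with x hx
  apply propext
  change y < ‖f x‖ₑ ↔ y < ‖g x‖ₑ
  rw [hx]

theorem lorentzNorm_congr_ae (q : ℝ) (θ : ℝ≥0∞) {f g : (Fin n → ℝ) → 𝕜} (h : f =ᵐ[volume] g) :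
    lorentzNorm q θ f = lorentzNorm q θ g := by
  simp only [lorentzNorm, rearrangement, distribution_congr_ae h]

theorem lorentzNorm_zero (q : ℝ) (θ : ℝ≥0∞) :
    lorentzNorm q θ (0 : (Fin n → ℝ) → 𝕜) = 0 := by
  have h : ∀ t, rearrangement (0 : (Fin n → ℝ) → 𝕜) t = 0 := fun t => by
    rw [rearrangement, ← nonpos_iff_eq_zero]
    exact sInf_le (by simp [distribution])
  simp only [lorentzNorm, h, mul_zero, scriptLNorm]
  exact eLpNorm_zero

theorem distribution_ofReal (f : (Fin n → ℝ) → 𝕜) {y : ℝ} (hy : 0 ≤ y) :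
    distribution f (ENNReal.ofReal y) = volume {x | y < ‖f x‖} := by
  simp only [distribution, ← ofReal_norm]
  congr 1
  ext x
  exact ENNReal.ofReal_lt_ofReal_iff_of_nonneg hy

theorem rearrangement_le (f : (Fin n → ℝ) → 𝕜) {t R : ℝ} (hR : 0 ≤ R)
    (h : ∀ y, ENNReal.ofReal t ≤ volume {x | y < ‖f x‖} → y ≤ R) :
    rearrangement f t ≤ ENNReal.ofReal R := by
  refine ENNReal.le_of_forall_pos_le_add fun δ hδ _ => ?_
  have hδ' : (0 : ℝ) < δ := hδ
  rw [← ENNReal.ofReal_coe_nnreal, ← ENNReal.ofReal_add hR hδ'.le]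
  refine sInf_le ?_
  rw [mem_ofPred_eq, distribution_ofReal f (by linarith)]
  by_contra hcon
  linarith [h _ (not_le.1 hcon).le]

theorem memS0_of_memLp {f : (Fin n → ℝ) → 𝕜} {p : ℝ} (hp : 0 < p)
    (hf : MemLp f (ENNReal.ofReal p) volume) : MemS0 f := by
  refine ⟨hf.1, fun y hy => ?_⟩
  have h := mul_meas_ge_le_pow_eLpNorm' volume (by simpa using hp) ENNReal.ofReal_ne_top hf.1
    (ENNReal.ofReal y)
  have htop : eLpNorm f (ENNReal.ofReal p) volume ^ (ENNReal.ofReal p).toReal < ∞ :=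
    ENNReal.rpow_lt_top_of_nonneg ENNReal.toReal_nonneg hf.2.ne
  have hpos : ENNReal.ofReal y ^ (ENNReal.ofReal p).toReal ≠ 0 := by
    rw [Ne, ENNReal.rpow_eq_zero_iff]
    simp [hy, hp.le, ENNReal.toReal_ofReal]
  have h2 := ENNReal.lt_top_of_mul_ne_top_right (h.trans_lt htop).ne hpos
  refine lt_of_le_of_lt (measure_mono fun x hx => ?_) h2
  exact (show ENNReal.ofReal y < ‖f x‖ₑ from hx).le

theorem volume_lt_norm_le_of_eLpNorm_le {g : (Fin n → ℝ) → 𝕜} (hg : Measurable g) {p ω l : ℝ}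
    (hp : 0 < p) (hω : 0 ≤ ω) (hl : 0 < l)
    (h : eLpNorm g (ENNReal.ofReal p) volume ≤ ENNReal.ofReal ω) :
    volume {x | l < ‖g x‖} ≤ ENNReal.ofReal ((ω / l) ^ p) := by
  have h1 := mul_meas_ge_le_pow_eLpNorm' volume (by simpa using hp) ENNReal.ofReal_ne_top
    hg.aestronglyMeasurable (ENNReal.ofReal l) (p := ENNReal.ofReal p)
  rw [ENNReal.toReal_ofReal hp.le] at h1
  have h2 := h1.trans (ENNReal.rpow_le_rpow h hp.le)
  rw [ENNReal.ofReal_rpow_of_pos hl, ENNReal.ofReal_rpow_of_nonneg hω hp.le, mul_comm,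
    ← ENNReal.le_div_iff_mul_le (Or.inl (by simpa using Real.rpow_pos_of_pos hl p))
      (Or.inl ENNReal.ofReal_ne_top),
    ← ENNReal.ofReal_div_of_pos (Real.rpow_pos_of_pos hl p), ← Real.div_rpow hω hl.le] at h2
  refine (measure_mono fun x hx => ?_).trans h2
  rw [mem_ofPred_eq, ← ofReal_norm]
  exact ENNReal.ofReal_le_ofReal (le_of_lt hx)

theorem exists_volume_diff_ball_le {s : Set (Fin n → ℝ)} (hs : MeasurableSet s)
    (ht : volume s ≠ ∞) {δ : ℝ≥0∞} (hδ : 0 < δ) :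
    ∃ R : ℕ, ∀ R' : ℕ, R ≤ R' → volume (s \ Metric.ball 0 (R' : ℝ)) ≤ δ := by
  have h := tendsto_measure_iInter_atTop (μ := volume)
    (s := fun R : ℕ => s \ Metric.ball 0 (R : ℝ))
    (fun R => (hs.diff measurableSet_ball).nullMeasurableSet)
    (fun R R' hR => sdiff_subset_sdiff_right (Metric.ball_subset_ball (by exact_mod_cast hR)))
    ⟨0, ne_top_of_le_ne_top ht (measure_mono sdiff_subset)⟩
  have hempty : ⋂ R : ℕ, s \ Metric.ball 0 (R : ℝ) = ∅ := by
    ext x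
    simp only [mem_iInter, mem_sdiff, Metric.mem_ball, dist_zero_right, not_lt, mem_empty_iff_false,
      iff_false, not_forall]
    obtain ⟨N, hN⟩ := exists_nat_gt ‖x‖
    exact ⟨N, fun hx => absurd hN (not_lt.2 hx.2)⟩
  rw [hempty, measure_empty] at h
  obtain ⟨R, hR⟩ := Filter.eventually_atTop.1 (h.eventually_le_const hδ)
  exact ⟨R, hR⟩

/-- A function of `S₀` annihilated by arbitrarily long differences vanishes. -/
theorem ae_eq_zero_of_difference_eq_zero {f : (Fin n → ℝ) → 𝕜} (hf : Measurable f)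
    (hS : ∀ y : ℝ, 0 < y → volume {x | y < ‖f x‖} ≠ ∞) (j : Fin n) (k : ℕ)
    (h : ∀ N : ℝ, ∃ s, N < s ∧ difference j k s f =ᵐ[volume] 0) : f =ᵐ[volume] 0 := by
  set K : ℝ := ∑ i ∈ Finset.Icc 1 k, ‖shiftCoeff 𝕜 k i‖ with hK
  have hK0 : 0 ≤ K := Finset.sum_nonneg fun _ _ => norm_nonneg _
  have hzero : ∀ y : ℝ, 0 < y → volume {x | (K + 1) * y < ‖f x‖} = 0 := by
    intro y hy
    set A := {x | (K + 1) * y < ‖f x‖} with hA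
    set B := {x | y < ‖f x‖} with hB
    have hAm : MeasurableSet A := measurableSet_lt measurable_const hf.norm
    have hBm : MeasurableSet B := measurableSet_lt measurable_const hf.norm
    have hle : ∀ δ : ℝ≥0∞, 0 < δ → volume A ≤ k * (δ + δ) := by
      intro δ hδ
      obtain ⟨R₁, hR₁⟩ := exists_volume_diff_ball_le hAm (hS _ (by positivity)) hδ
      obtain ⟨R₂, hR₂⟩ := exists_volume_diff_ball_le hBm (hS _ hy) hδ
      set R := max R₁ R₂ with hR
      obtain ⟨s, hs, hsf⟩ := h (2 * R)
      -- As `f` is a.e. a combination of its shifts by `i s`, `1 ≤ i ≤ k`, some shift is large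
      -- wherever `f` is. With `s > 2R` the points `x` and `x + i s e_j` cannot both lie in the ball
      -- of radius `R`, so one lies in a tail of measure at most `δ`.
      have hsub : ∀ᵐ x, x ∈ A → x ∈ ⋃ i ∈ Finset.Icc 1 k,
          ((A \ Metric.ball 0 (R : ℝ)) ∪ (fun x => x + Pi.single j ((i : ℝ) * s)) ⁻¹'
            (B \ Metric.ball 0 (R : ℝ))) := by
        filter_upwards [hsf] with x hx hxA
        have h1 := congrFun (shiftAct_one_sub_axisMean j k s f) x
        rw [Pi.smul_apply, hx, Pi.zero_apply, smul_zero, shiftAct_one_sub, sub_eq_zero, axisMean,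
          shiftAct_sum_single] at h1
        have h2 : (K + 1) * y < ‖f x‖ := hxA
        rw [h1] at h2
        obtain ⟨i, hi, hlt⟩ := exists_lt_norm_of_sum (by linarith) hy.le h2
        refine mem_biUnion hi ?_
        by_cases hxb : x ∈ Metric.ball 0 (R : ℝ)
        · refine Or.inr ⟨hlt, fun hxb' => ?_⟩
          rw [mem_ball_zero_iff] at hxb hxb'
          have h3 : ‖(Pi.single j ((i : ℝ) * s) : Fin n → ℝ)‖ < 2 * R := by
            have := norm_sub_le (x + Pi.single j ((i : ℝ) * s)) x
            rw [add_sub_cancel_left] at this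
            linarith
          rw [Pi.norm_single, Real.norm_eq_abs] at h3
          have h4 : (1 : ℝ) ≤ i := by exact_mod_cast (Finset.mem_Icc.1 hi).1
          have h5 : (0 : ℝ) ≤ R := Nat.cast_nonneg _
          have h6 := le_abs_self ((i : ℝ) * s)
          nlinarith
        · exact Or.inl ⟨hxA, hxb⟩
      refine (measure_mono_ae hsub).trans ((measure_biUnion_finset_le _ _).trans ?_)
      calc _ ≤ ∑ i ∈ Finset.Icc 1 k, (δ + δ) := by
            refine Finset.sum_le_sum fun i _ => (measure_union_le _ _).trans ?_
            rw [measure_preimage_add_right]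
            exact add_le_add (hR₁ R (le_max_left _ _)) (hR₂ R (le_max_right _ _))
        _ = k * (δ + δ) := by rw [Finset.sum_const, nsmul_eq_mul, Nat.card_Icc, Nat.add_sub_cancel]
    by_contra hne
    -- With this `δ` the bound `k * (δ + δ)` is at most half of `volume A`.
    have hpos : 0 < volume A / (4 * (k + 1)) := by
      refine ENNReal.div_pos hne ?_
      finiteness
    have h1 := hle _ hpos
    have hAt : volume A ≠ ∞ := hS _ (by positivity)
    lift volume A to ℝ≥0 using hAt with a
    have hk1 : (4 * ((k : ℝ≥0∞) + 1)) = ((4 * ((k : ℝ≥0) + 1) : ℝ≥0) : ℝ≥0∞) := by push_cast; rfl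
    rw [hk1, ← ENNReal.coe_div (by positivity)] at h1
    norm_cast at h1 hne
    rw [← NNReal.coe_le_coe] at h1
    push_cast at h1
    have ha : (0 : ℝ) < a := lt_of_le_of_ne a.coe_nonneg (fun h => hne (by exact_mod_cast h.symm))
    have h2 : (k : ℝ) * (a / (4 * (k + 1)) + a / (4 * (k + 1))) ≤ a / 2 := by
      have : (k : ℝ) * (a / (4 * (k + 1)) + a / (4 * (k + 1))) = a / 2 * (k / (k + 1)) := by
        field_simp
        ring
      rw [this]
      refine mul_le_of_le_one_right (by positivity) ?_
      rw [div_le_one (by positivity)]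
      linarith
    linarith
  have hall : ∀ m : ℕ, ∀ᵐ x, ¬ (K + 1) * (1 / ((m : ℝ) + 1)) < ‖f x‖ := fun m =>
    measure_eq_zero_iff_ae_notMem.1 (hzero _ (by positivity))
  filter_upwards [ae_all_iff.2 hall] with x hx
  by_contra hne
  have hpos : 0 < ‖f x‖ / (K + 1) := div_pos (norm_pos_iff.2 hne) (by linarith)
  obtain ⟨m, hm⟩ := exists_nat_one_div_lt hpos
  refine hx m ?_
  rw [lt_div_iff₀ (by linarith)] at hm
  linarith

/-- Almost every step annihilates `f`, so arbitrarily long ones do. This settles the case `0 · ∞ =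
0` of the product and allows logarithms to be taken otherwise. -/
theorem ae_eq_zero_of_besovSeminorm_eq_zero {f : (Fin n → ℝ) → 𝕜} (hf : Measurable f)
    (hS : ∀ y : ℝ, 0 < y → volume {x | y < ‖f x‖} ≠ ∞) (j : Fin n) (k : ℕ) {r p : ℝ} (hp : 0 < p)
    {θ : ℝ≥0∞} (hθ : θ ≠ 0) (h : besovSeminorm j k r p θ f = 0) : f =ᵐ[volume] 0 := by
  refine ae_eq_zero_of_difference_eq_zero hf hS j k fun N => ?_
  rw [besovSeminorm, scriptLNorm_eq_exp, eLpNorm_eq_zero_iff _ hθ] at h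
  · have hN : ∃ᵐ v : ℝ, Real.log (max N 1) < v := by
      rw [frequently_ae_iff]
      change volume (Ioi _) ≠ 0
      simp
    obtain ⟨v, hv, hv0⟩ := (hN.and_eventually h).exists
    refine ⟨Real.exp v, ?_, ?_⟩
    · rw [Real.log_lt_iff_lt_exp (by positivity)] at hv
      exact (le_max_left _ _).trans_lt hv
    · rw [Pi.zero_apply, mul_eq_zero] at hv0
      rcases hv0 with h0 | h0
      · have := Real.rpow_pos_of_pos (Real.exp_pos v) (-r)
        rw [ENNReal.ofReal_eq_zero] at h0
        linarith
      · exact (eLpNorm_eq_zero_iff (measurable_difference j k hf measurable_const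
          measurable_id).aestronglyMeasurable (by simpa using hp)).1 h0
  · refine Measurable.aestronglyMeasurable (Measurable.mul ?_
      ((measurable_eLpNorm_difference j k hf hp).comp Real.measurable_exp))
    exact ENNReal.measurable_ofReal.comp (Real.measurable_exp.pow_const _)

/-- Most steps in a dyadic interval are not worse than the average one. -/
theorem volume_good_steps_ge {φ : ℝ → ℝ≥0∞} (hφ : Measurable φ) {r v a : ℝ} (hr : 0 < r)
    (h : ∫⁻ w in Icc v (v + Real.log 2), ENNReal.ofReal (Real.exp w ^ (-r)) * φ (Real.exp w)
      ≤ ENNReal.ofReal (2 * Real.exp a)) :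
    ENNReal.ofReal (Real.exp v / 2) ≤ volume {s ∈ Icc (Real.exp v) (2 * Real.exp v) |
      φ s ≤ ENNReal.ofReal (8 * 2 ^ r * Real.exp (r * v + a))} := by
  set I := Icc (Real.exp v) (2 * Real.exp v) with hI
  set ω := 8 * 2 ^ r * Real.exp (r * v + a) with hω
  have h2r : (0 : ℝ) < 2 ^ r := Real.rpow_pos_of_pos two_pos r
  have hωpos : 0 < ω := by positivity
  have hexp2 : Real.exp (v + Real.log 2) = 2 * Real.exp v := by
    rw [Real.exp_add, Real.exp_log two_pos, mul_comm]
  have himg : Real.exp '' Icc v (v + Real.log 2) = I := by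
    rw [hI, ← hexp2]
    ext s
    constructor
    · rintro ⟨w, ⟨h1, h2⟩, rfl⟩
      exact ⟨Real.exp_le_exp.2 h1, Real.exp_le_exp.2 h2⟩
    · rintro ⟨h1, h2⟩
      have hs : 0 < s := (Real.exp_pos v).trans_le h1
      exact ⟨Real.log s, ⟨(Real.le_log_iff_exp_le hs).2 h1, (Real.log_le_iff_le_exp hs).2 h2⟩,
        Real.exp_log hs⟩
  -- Substituting `s = e^w` costs at most `2 e^v (2 e^v)^r`. The 8 in `ω` is chosen so that
  -- Chebyshev bounds the bad steps by `e^v / 2`, half the length of `I`.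
  have hint : ∫⁻ s in I, φ s ≤ ENNReal.ofReal (Real.exp v / 2) * ENNReal.ofReal ω := by
    rw [← himg, lintegral_image_eq_lintegral_abs_deriv_mul measurableSet_Icc
      (fun x _ => (Real.hasDerivAt_exp x).hasDerivWithinAt) Real.exp_injective.injOn]
    calc ∫⁻ w in Icc v (v + Real.log 2), ENNReal.ofReal |Real.exp w| * φ (Real.exp w)
        ≤ ∫⁻ w in Icc v (v + Real.log 2), ENNReal.ofReal (2 * Real.exp v * (2 * Real.exp v) ^ r) *
            (ENNReal.ofReal (Real.exp w ^ (-r)) * φ (Real.exp w)) := by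
          refine setLIntegral_mono' measurableSet_Icc fun w hw => ?_
          rw [← mul_assoc, ← ENNReal.ofReal_mul (by positivity)]
          gcongr
          have hle : Real.exp w ≤ 2 * Real.exp v := by
            rw [← hexp2]
            exact Real.exp_le_exp.2 hw.2
          rw [abs_of_pos (Real.exp_pos w), Real.rpow_neg (Real.exp_pos w).le, mul_assoc]
          have h3 : 1 ≤ (2 * Real.exp v) ^ r * (Real.exp w ^ r)⁻¹ := by
            rw [← div_eq_mul_inv, one_le_div (Real.rpow_pos_of_pos (Real.exp_pos w) r)]
            exact Real.rpow_le_rpow (Real.exp_pos w).le hle hr.le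
          nlinarith [Real.exp_pos v]
      _ ≤ ENNReal.ofReal (2 * Real.exp v * (2 * Real.exp v) ^ r) *
            ENNReal.ofReal (2 * Real.exp a) := by
          rw [lintegral_const_mul' _ _ ENNReal.ofReal_ne_top]
          gcongr
      _ = ENNReal.ofReal (Real.exp v / 2) * ENNReal.ofReal ω := by
          rw [← ENNReal.ofReal_mul (by positivity), ← ENNReal.ofReal_mul (by positivity)]
          congr 1
          rw [hω, Real.mul_rpow two_pos.le (Real.exp_pos v).le, ← Real.exp_mul, Real.exp_add,
            mul_comm v r]
          ring
  have hbad : volume {s ∈ I | ENNReal.ofReal ω < φ s} ≤ ENNReal.ofReal (Real.exp v / 2) := by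
    have h1 := mul_meas_ge_le_lintegral (μ := volume.restrict I) hφ (ENNReal.ofReal ω)
    rw [Measure.restrict_apply (measurableSet_le measurable_const hφ)] at h1
    have h2 : ENNReal.ofReal ω * volume {s ∈ I | ENNReal.ofReal ω < φ s}
        ≤ ENNReal.ofReal ω * ENNReal.ofReal (Real.exp v / 2) := by
      rw [mul_comm _ (ENNReal.ofReal (Real.exp v / 2))]
      refine le_trans ?_ (h1.trans hint)
      gcongr
      rintro s ⟨hs, hs'⟩
      exact ⟨hs'.le, hs⟩
    rwa [ENNReal.mul_le_mul_iff_right (by simpa using hωpos) ENNReal.ofReal_ne_top] at h2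
  have hcover : I ⊆ {s ∈ I | φ s ≤ ENNReal.ofReal ω} ∪ {s ∈ I | ENNReal.ofReal ω < φ s} := by
    intro s hs
    rcases le_or_gt (φ s) (ENNReal.ofReal ω) with h | h
    · exact Or.inl ⟨hs, h⟩
    · exact Or.inr ⟨hs, h⟩
  have hvol := (measure_mono hcover).trans (measure_union_le (μ := volume) _ _)
  have hIvol : volume I = ENNReal.ofReal (Real.exp v / 2) + ENNReal.ofReal (Real.exp v / 2) := by
    rw [hI, Real.volume_Icc, ← ENNReal.ofReal_add (by positivity) (by positivity)]
    congr 1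
    ring
  rw [hIvol] at hvol
  exact (ENNReal.add_le_add_iff_right ENNReal.ofReal_ne_top).1
    (hvol.trans (add_le_add le_rfl hbad))

end Differences

/-! ### Arithmetic of the exponents. -/

section Parameters

variable {n : ℕ} {r p : Fin n → ℝ}

theorem sum_inv_pos (hn : 0 < n) (hr : ∀ j, 0 < r j) : 0 < ∑ j, 1 / r j := by
  have : Nonempty (Fin n) := ⟨⟨0, hn⟩⟩
  exact Finset.sum_pos (fun j _ => one_div_pos.2 (hr j)) Finset.univ_nonempty

theorem meanR_div (hn : 0 < n) : meanR r / n = (∑ j, 1 / r j)⁻¹ := by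
  have : (n : ℝ) ≠ 0 := by exact_mod_cast hn.ne'
  rw [meanR]
  field_simp

theorem meanR_div_pos (hn : 0 < n) (hr : ∀ j, 0 < r j) : 0 < meanR r / n := by
  rw [meanR_div hn]
  exact inv_pos.2 (sum_inv_pos hn hr)

theorem meanR_div_mul_sum (hn : 0 < n) (hr : ∀ j, 0 < r j) :
    meanR r / n * ∑ j, 1 / r j = 1 := by
  rw [meanR_div hn]
  exact inv_mul_cancel₀ (sum_inv_pos hn hr).ne'

theorem one_div_meanP (hn : 0 < n) :
    1 / meanP r p = meanR r / n * ∑ j, 1 / (p j * r j) := by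
  have : (n : ℝ) ≠ 0 := by exact_mod_cast hn.ne'
  rw [meanP, one_div, mul_inv, inv_inv, inv_div]

theorem meanP_pos (hn : 0 < n) (hr : ∀ j, 0 < r j) (hp : ∀ j, 0 < p j) : 0 < meanP r p := by
  rw [← one_div_pos, one_div_meanP hn]
  have : Nonempty (Fin n) := ⟨⟨0, hn⟩⟩
  exact mul_pos (meanR_div_pos hn hr) (Finset.sum_pos
    (fun j _ => one_div_pos.2 (mul_pos (hp j) (hr j))) Finset.univ_nonempty)

theorem one_div_qStar (hn : 0 < n) (hr : ∀ j, 0 < r j) (hp : ∀ j, 0 < p j) :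
    1 / qStar r p = 1 / meanP r p - meanR r / n := by
  have h1 : (n : ℝ) ≠ 0 := by exact_mod_cast hn.ne'
  have h2 := (meanP_pos hn hr hp).ne'
  rw [qStar, one_div_div]
  field_simp

theorem qStar_pos (hn : 0 < n) (hr : ∀ j, 0 < r j) (hp : ∀ j, 0 < p j)
    (hpr : meanP r p < n / meanR r) : 0 < qStar r p := by
  rw [← one_div_pos, one_div_qStar hn hr hp, sub_pos, ← one_div_div]
  exact one_div_lt_one_div_of_lt (meanP_pos hn hr hp) hpr

/-- This turns the balanced value `r_j β_j u + L(u)` into `u/p_j + (-u/q* + L(u))`, whose second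
summand does not depend on `j`. -/
theorem mul_beta (hn : 0 < n) (hr : ∀ j, 0 < r j) (hp : ∀ j, 0 < p j) (j : Fin n) :
    r j * beta r p j = 1 / p j - 1 / qStar r p := by
  rw [beta, one_div_qStar hn hr hp, ← mul_assoc, mul_one_div_cancel (hr j).ne']
  ring

/-- Dividing `mul_beta` by `r_j` and summing with weight `r/n` gives `1/p - 1/q* = r/n`. It lets the
balanced step sizes have product `t`. -/
theorem sum_beta (hn : 0 < n) (hr : ∀ j, 0 < r j) (hp : ∀ j, 0 < p j) :
    ∑ j, beta r p j = 1 := by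
  have h1 : ∀ j, beta r p j = 1 / (p j * r j) - 1 / qStar r p * (1 / r j) := fun j => by
    have h := mul_beta hn hr hp j
    have h2 := (hr j).ne'
    have h3 := (hp j).ne'
    have h4 : beta r p j = (1 / p j - 1 / qStar r p) / r j := by
      rw [← h, mul_div_cancel_left₀ _ h2]
    rw [h4, sub_div, div_div, mul_one_div]
  have h5 := one_div_meanP (r := r) (p := p) hn
  have h6 := one_div_qStar hn hr hp
  have h7 := meanR_div_mul_sum hn hr
  have h8 := (meanR_div_pos hn hr).ne'
  rw [Finset.sum_congr rfl fun j _ => h1 j, Finset.sum_sub_distrib, ← Finset.mul_sum]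
  refine mul_left_cancel₀ h8 ?_
  linear_combination (-1) * h5 - 1 / qStar r p * h7 - h6

/-- The Hölder relation for the weights `r/(n r_j)`, in a form valid for infinite exponents. -/
theorem meanTheta_inv (hn : 0 < n) (hr : ∀ j, 0 < r j) (θ : Fin n → ℝ≥0∞) :
    (meanTheta r θ)⁻¹ = ∑ j, ENNReal.ofReal (meanR r / (n * r j)) * (θ j)⁻¹ := by
  have hρ := meanR_div_pos hn hr
  have hρ' : 0 < n / meanR r := by
    rw [← one_div_div]
    exact one_div_pos.2 hρ
  rw [meanTheta, ENNReal.mul_inv (Or.inl (by simpa using hρ')) (Or.inl ENNReal.ofReal_ne_top),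
    inv_inv, Finset.mul_sum]
  refine Finset.sum_congr rfl fun j _ => ?_
  rw [ENNReal.mul_inv (Or.inr ENNReal.ofReal_ne_top) (Or.inr (by simpa using hr j)),
    ← ENNReal.ofReal_inv_of_pos hρ', ← ENNReal.ofReal_inv_of_pos (hr j), mul_left_comm,
    ← ENNReal.ofReal_mul (by positivity), mul_comm, inv_div,
    ← div_eq_mul_inv (meanR r / n), div_div, mul_comm]

end Parameters

/-! ### Pointwise bound for the rearrangement and the norm inequality. -/

section Main

variable {n : ℕ} {𝕜 : Type*} [RCLike 𝕜]

/-- The function `w ↦ e^{-r w} ‖Δ_j^k(e^w) f‖_p`, whose `L^θ(ℝ)` norm is the Besov seminorm. -/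
noncomputable def logModulus (j : Fin n) (k : ℕ) (r p : ℝ) (f : (Fin n → ℝ) → 𝕜) (w : ℝ) : ℝ≥0∞ :=
  ENNReal.ofReal (Real.exp w ^ (-r)) *
    eLpNorm (difference j k (Real.exp w) f) (ENNReal.ofReal p) volume

theorem besovSeminorm_eq (j : Fin n) (k : ℕ) (r p : ℝ) (θ : ℝ≥0∞) (f : (Fin n → ℝ) → 𝕜) :
    besovSeminorm j k r p θ f = eLpNorm (logModulus j k r p f) θ volume :=
  scriptLNorm_eq_exp _ _

theorem measurable_logModulus (j : Fin n) (k : ℕ) (r : ℝ) {p : ℝ} (hp : 0 < p)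
    {f : (Fin n → ℝ) → 𝕜} (hf : Measurable f) : Measurable (logModulus j k r p f) :=
  (ENNReal.measurable_ofReal.comp (Real.measurable_exp.pow_const _)).mul
    ((measurable_eLpNorm_difference j k hf hp).comp Real.measurable_exp)

/-- The pointwise bound for the rearrangement in terms of balanced scales. -/
theorem exists_rearrangement_exp_le (r p β : Fin n → ℝ) (k : Fin n → ℕ) {q ε : ℝ}
    (hn : 0 < n) (hr : ∀ j, 0 < r j) (hp : ∀ j, 1 ≤ p j) (hεq : 2 * ε < 1 / q)
    (hrβ : ∀ j, r j * β j = 1 / p j - 1 / q) :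
    ∃ C : ℝ, 0 ≤ C ∧ ∀ f : (Fin n → ℝ) → 𝕜, Measurable f →
      (∀ y : ℝ, 0 < y → volume {x | y < ‖f x‖} ≠ ∞) →
      ∀ (ℓ : Fin n → ℝ → ℝ) (v : ℝ → Fin n → ℝ) (L : ℝ → ℝ),
      (∀ j v, ∫⁻ w in Icc v (v + Real.log 2), logModulus j (k j) (r j) (p j) f w
        ≤ ENNReal.ofReal (2 * Real.exp (ℓ j v))) →
      (∀ u, ∑ j, v u j = u) → (∀ u j, r j * v u j + ℓ j (v u j) = r j * β j * u + L u) →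
      (∀ u u', |L u - L u'| ≤ 2 * ε * |u - u'|) →
      ∀ u, rearrangement f (Real.exp u) ≤ ENNReal.ofReal (C * Real.exp (-(u / q) + L u)) := by
  obtain ⟨K, hK1, hK⟩ := exists_volume_shiftMean_le (𝕜 := 𝕜) k
  obtain ⟨N, hN⟩ := exists_volume_one_sub_prod_axisMean_le (𝕜 := 𝕜) k Finset.univ
  have hKpos : (0 : ℝ) < K := by exact_mod_cast hK1
  set γ : ℝ := (1 / 2) ^ n with hγ
  have hγpos : 0 < γ := by positivity
  have hγ1 : γ ≤ 1 := pow_le_one₀ (by norm_num) (by norm_num)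
  set S : ℝ := ∑ j, 8 * (2 : ℝ) ^ r j with hS
  have hterm : ∀ j, (0 : ℝ) < 8 * 2 ^ r j := fun j => by positivity
  have hSle : ∀ j, 8 * (2 : ℝ) ^ r j ≤ S := fun j =>
    Finset.single_le_sum (f := fun j => 8 * (2 : ℝ) ^ r j) (fun i _ => (hterm i).le)
      (Finset.mem_univ j)
  have hSpos : 0 < S := (hterm ⟨0, hn⟩).trans_le (hSle _)
  -- Chosen so that `N * S / C₀ ≤ γ / (16 * K)`, as the chain lemma requires, and so that `8 * 2 ^ r
  -- j / C₀ ≤ 1`, which its `p j`-th power then does not exceed.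
  set C₀ : ℝ := (N + 1) * (16 * K / γ) * S with hC₀
  have hC₀pos : 0 < C₀ := by positivity
  have hSC₀ : S ≤ C₀ := by
    have h1 : (1 : ℝ) ≤ 16 * K / γ := by
      rw [le_div_iff₀ hγpos]
      have : (1 : ℝ) ≤ K := by exact_mod_cast hK1
      linarith
    have h2 : (1 : ℝ) ≤ N + 1 := by linarith [(Nat.cast_nonneg N : (0 : ℝ) ≤ N)]
    have h3 : (1 : ℝ) ≤ (N + 1) * (16 * K / γ) := one_le_mul_of_one_le_of_one_le h2 h1
    exact le_mul_of_one_le_left hSpos.le h3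
  -- Ratio of the geometric majorant of `X m`: doubling the scale gains `1 / q` and loses at most `2
  -- ε` through `L`.
  set x₀ : ℝ := Real.exp (-((1 / q - 2 * ε) * Real.log 2)) with hx₀
  have hx₀1 : x₀ < 1 := by
    rw [hx₀, Real.exp_lt_one_iff]
    have := Real.log_pos one_lt_two
    nlinarith
  have hx₀pos : 0 < x₀ := Real.exp_pos _
  refine ⟨(1 + 2 * K) * (N * C₀ * (1 - x₀)⁻¹), ?_, ?_⟩
  · have : 0 < 1 - x₀ := by linarith
    positivity
  intro f hf hfS ℓ v L hℓ hsum hbal hL u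
  have hlog2 := Real.log_pos one_lt_two
  set U : ℕ → ℝ := fun m => u + m * Real.log 2 with hU
  have hexpU : ∀ m, Real.exp (U m) = 2 ^ m * Real.exp u := fun m => by
    rw [hU]
    simp only
    rw [Real.exp_add, Real.exp_nat_mul, Real.exp_log two_pos, mul_comm]
  set X : ℕ → ℝ := fun m => Real.exp (-(U m / q) + L (U m)) with hX
  have hXpos : ∀ m, 0 < X m := fun m => Real.exp_pos _
  have hXle : ∀ m, X m ≤ Real.exp (-(u / q) + L u) * x₀ ^ m := by
    intro m
    rw [hX, hx₀, ← Real.exp_nat_mul, ← Real.exp_add]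
    refine Real.exp_le_exp.2 ?_
    have h1 := (le_abs_self _).trans (hL (U m) u)
    have h2 : U m - u = m * Real.log 2 := by
      rw [hU]
      ring
    rw [h2, abs_of_nonneg (by positivity)] at h1
    have h3 : U m / q = u / q + m * Real.log 2 * (1 / q) := by
      rw [hU]
      ring
    rw [h3]
    linarith
  set ω : ℕ → Fin n → ℝ := fun m j => 8 * 2 ^ r j * Real.exp (r j * v (U m) j + ℓ j (v (U m) j))
    with hω
  set G : ℕ → Set (Fin n → ℝ) := fun m => univ.pi fun j =>
    {s ∈ Icc (Real.exp (v (U m) j)) (2 * Real.exp (v (U m) j)) |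
      eLpNorm (difference j (k j) s f) (ENNReal.ofReal (p j)) volume ≤ ENNReal.ofReal (ω m j)}
    with hG
  refine rearrangement_le f (by have : 0 < 1 - x₀ := by linarith
                                positivity) fun y hy => ?_
  refine level_le_of_chain (γ := γ) (G := G) (l := fun m => N * (C₀ * X m)) hf hfS hK1 hK
    (Real.exp_pos u) hγpos hγ1 ?_ ?_ ?_ ?_ ?_ ?_ hy
  · intro m
    refine MeasurableSet.univ_pi fun j => measurableSet_Icc.inter (measurableSet_le
      (measurable_eLpNorm_difference j (k j) hf (zero_lt_one.trans_le (hp j))) measurable_const)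
  · intro m
    rw [hG, volume_pi_pi]
    refine ENNReal.prod_ne_top fun j _ => ?_
    exact ne_top_of_le_ne_top (by simp : volume (Icc (Real.exp (v (U m) j))
      (2 * Real.exp (v (U m) j))) ≠ ∞) (measure_mono fun s hs => hs.1)
  · intro m
    rw [hG, volume_pi_pi]
    calc ENNReal.ofReal (γ * (2 ^ m * Real.exp u))
        = ∏ j, ENNReal.ofReal (Real.exp (v (U m) j) / 2) := by
          rw [← ENNReal.ofReal_prod_of_nonneg (fun j _ => by positivity), ← hexpU, ← hsum (U m),
            Real.exp_sum, hsum (U m), hγ]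
          congr 1
          rw [Finset.prod_div_distrib, Finset.prod_const, Finset.card_univ, Fintype.card_fin,
            one_div, inv_pow, mul_comm, div_eq_mul_inv]
      _ ≤ _ := by
          refine Finset.prod_le_prod' fun j _ => ?_
          exact volume_good_steps_ge
            (measurable_eLpNorm_difference j (k j) hf (zero_lt_one.trans_le (hp j))) (hr j)
            (hℓ j (v (U m) j))
  · intro m
    have := hXpos m
    positivity
  · intro m h hh
    have hl : 0 < C₀ * X m := mul_pos hC₀pos (hXpos m)
    refine (hN h f (C₀ * X m) hl.le).trans ?_
    have hj : ∀ j, volume {x | C₀ * X m < ‖difference j (k j) (h j) f x‖}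
        ≤ ENNReal.ofReal (8 * 2 ^ r j / C₀ * (2 ^ m * Real.exp u)) := by
      intro j
      have hpj : 0 < p j := zero_lt_one.trans_le (hp j)
      refine (volume_lt_norm_le_of_eLpNorm_le
        (measurable_difference j (k j) hf measurable_const measurable_id) hpj
        (by positivity : 0 ≤ ω m j) hl (hh j (mem_univ j)).2).trans ?_
      refine ENNReal.ofReal_le_ofReal ?_
      -- The balance equation is used here: the `p j`-th power of the last factor is `exp (U m) = 2
      -- ^ m * exp u` for every `j`.
      have h1 : ω m j / (C₀ * X m) = 8 * 2 ^ r j / C₀ * Real.exp (U m / p j) := by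
        have h2 : r j * v (U m) j + ℓ j (v (U m) j) = U m / p j + (-(U m / q) + L (U m)) := by
          rw [hbal, hrβ]
          ring
        rw [hω, hX]
        simp only
        rw [h2, Real.exp_add]
        field_simp
      rw [h1, Real.mul_rpow (by positivity) (Real.exp_pos _).le, ← Real.exp_mul,
        div_mul_cancel₀ _ hpj.ne', hexpU]
      refine mul_le_mul_of_nonneg_right ?_ (by positivity)
      refine (Real.rpow_le_rpow_of_exponent_ge (by positivity) ?_ (hp j)).trans_eq
        (Real.rpow_one _)
      rw [div_le_one hC₀pos]
      exact (hSle j).trans hSC₀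
    calc (N : ℝ≥0∞) * ∑ j, volume {x | C₀ * X m < ‖difference j (k j) (h j) f x‖}
        ≤ N * ∑ j, ENNReal.ofReal (8 * 2 ^ r j / C₀ * (2 ^ m * Real.exp u)) := by
          gcongr with j
          exact hj j
      _ = ENNReal.ofReal (N * (S / C₀ * (2 ^ m * Real.exp u))) := by
          rw [← ENNReal.ofReal_sum_of_nonneg (fun j _ => by positivity), ← ENNReal.ofReal_natCast,
            ← ENNReal.ofReal_mul (Nat.cast_nonneg N), ← Finset.sum_mul, ← Finset.sum_div]
      _ ≤ _ := by
          refine ENNReal.ofReal_le_ofReal ?_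
          rw [← mul_assoc]
          refine mul_le_mul_of_nonneg_right ?_ (by positivity)
          have h1 : N * (S / C₀) = N / (N + 1) * (γ / (16 * K)) := by
            rw [hC₀]
            field_simp
          rw [h1]
          refine mul_le_of_le_one_left (by positivity) ?_
          rw [div_le_one (by positivity)]
          linarith
  · intro M
    rw [mul_assoc]
    refine mul_le_mul_of_nonneg_left ?_ (by positivity)
    calc ∑ m ∈ Finset.range M, N * (C₀ * X m)
        ≤ ∑ m ∈ Finset.range M, N * C₀ * Real.exp (-(u / q) + L u) * x₀ ^ m := by
          refine Finset.sum_le_sum fun m _ => ?_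
          rw [← mul_assoc, mul_assoc (N * C₀)]
          exact mul_le_mul_of_nonneg_left (hXle m) (by positivity)
      _ ≤ N * C₀ * Real.exp (-(u / q) + L u) * (1 - x₀)⁻¹ := by
          rw [← Finset.mul_sum]
          refine mul_le_mul_of_nonneg_left ?_ (by positivity)
          rw [← tsum_geometric_of_lt_one hx₀pos.le hx₀1]
          exact (summable_geometric_of_lt_one hx₀pos.le hx₀1).sum_le_tsum _
            (fun i _ => by positivity)
      _ = _ := by ring

theorem exists_lorentzNorm_le (hn : 0 < n) (r p : Fin n → ℝ) (θ : Fin n → ℝ≥0∞) (k : Fin n → ℕ)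
    (hr : ∀ j, 0 < r j) (hp : ∀ j, 1 ≤ p j) (hθ : ∀ j, 1 ≤ θ j) (hβ : ∀ j, 0 < beta r p j)
    (hpr : meanP r p < n / meanR r) :
    ∃ c : ℝ≥0, ∀ f : (Fin n → ℝ) → 𝕜, Measurable f →
      (∀ y : ℝ, 0 < y → volume {x | y < ‖f x‖} ≠ ∞) →
      (∀ j, besovSeminorm j (k j) (r j) (p j) (θ j) f ≠ 0) →
      (∀ j, besovSeminorm j (k j) (r j) (p j) (θ j) f ≠ ∞) →
      lorentzNorm (qStar r p) (meanTheta r θ) f ≤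
        c * ∏ j, besovSeminorm j (k j) (r j) (p j) (θ j) f ^ (meanR r / (n * r j)) := by
  have hp0 : ∀ j, 0 < p j := fun j => zero_lt_one.trans_le (hp j)
  have hq := qStar_pos hn hr hp0 hpr
  have hne : Nonempty (Fin n) := ⟨⟨0, hn⟩⟩
  set q := qStar r p with hqdef
  set w : Fin n → ℝ := fun j => meanR r / (n * r j) with hw
  have hρ := meanR_div_pos hn hr
  have hweq : ∀ j, w j = meanR r / n * (1 / r j) := fun j => by
    rw [hw]
    simp only
    rw [div_mul_div_comm, mul_one]
  have hwpos : ∀ j, 0 < w j := fun j => by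
    rw [hweq]
    exact mul_pos hρ (one_div_pos.2 (hr j))
  have hw1 : ∑ j, w j = 1 := by
    rw [Finset.sum_congr rfl fun j _ => hweq j, ← Finset.mul_sum, meanR_div_mul_sum hn hr]
  have hwr : ∀ j, w j * r j = meanR r / n := fun j => by
    rw [hweq, mul_assoc, one_div_mul_cancel (hr j).ne', mul_one]
  obtain ⟨jb, hjb⟩ := Finite.exists_min (beta r p)
  obtain ⟨jr, hjr⟩ := Finite.exists_min r
  set b := beta r p jb with hb
  have hbpos : 0 < b := hβ jb
  have hb1 : b ≤ 1 := by
    rw [← sum_beta hn hr hp0]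
    exact Finset.single_le_sum (fun i _ => (hβ i).le) (Finset.mem_univ jb)
  set κ : ℝ := b / 4 with hκ
  -- The three bounds serve the local-average majorant, the contraction, and the geometric decay.
  -- With `κ = b / 4` the functions `v_j` have increments at least `b / 2` times those of `u`,
  -- whence the constant `a = 2 / b`.
  set ε : ℝ := min 1 (min (κ * r jr / 2) (1 / (4 * q))) with hε
  have hεpos : 0 < ε := by
    have := hr jr
    positivity
  have hε1 : ε ≤ 1 := min_le_left _ _
  have hεκ : ∀ j, 2 * ε ≤ κ * r j := fun j => by
    have h1 : ε ≤ κ * r jr / 2 := (min_le_right _ _).trans (min_le_left _ _)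
    have h2 : κ * r jr ≤ κ * r j := mul_le_mul_of_nonneg_left (hjr j) (by positivity)
    linarith
  have hεq : 2 * ε < 1 / q := by
    have h1 : ε ≤ 1 / (4 * q) := (min_le_right _ _).trans (min_le_right _ _)
    have h2 : 1 / (4 * q) = 1 / q / 4 := by
      field_simp
    have h3 : 0 < 1 / q := one_div_pos.2 hq
    linarith
  obtain ⟨C, hC0, hC⟩ := exists_rearrangement_exp_le (𝕜 := 𝕜) r p (beta r p) k hn hr hp hεq
    (mul_beta hn hr hp0)
  set a : ℝ≥0 := (2 / b).toNNReal with ha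
  have hab : (a : ℝ) = 2 / b := Real.coe_toNNReal _ (by positivity)
  have ha1 : 1 ≤ a := by
    rw [← NNReal.coe_le_coe, hab, NNReal.coe_one, one_le_div hbpos]
    linarith
  have hmass := expMass_ne_top hεpos
  have hconst : ∏ j, ((a : ℝ≥0∞) * expMass ε) ^ w j ≠ ∞ := ENNReal.prod_ne_top fun j _ =>
    ENNReal.rpow_ne_top_of_nonneg (hwpos j).le (ENNReal.mul_ne_top ENNReal.coe_ne_top hmass)
  refine ⟨C.toNNReal * (∏ j, ((a : ℝ≥0∞) * expMass ε) ^ w j).toNNReal,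
    fun f hf hfS h0 htop => ?_⟩
  have hmaj := fun j => exists_log_lipschitz_majorant hεpos hε1
    (measurable_logModulus j (k j) (r j) (hp0 j) hf) (hθ j)
    (by rw [← besovSeminorm_eq]; exact h0 j) (by rw [← besovSeminorm_eq]; exact htop j)
  choose ℓ hℓlip hℓnorm hℓint using hmaj
  obtain ⟨v, L, hLdef, hsum, hbal, hLlip, hvlip⟩ := exists_balanced hr (fun j => (hβ j).le)
    (sum_beta hn hr hp0) (fun j => (hwpos j).le) hw1 hρ.ne' hwr hεpos.le
    (by rw [hκ]; linarith : κ ≤ 1 / 2) hεκ hℓlip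
  have hrear := hC f hf hfS ℓ v L hℓint hsum hbal hLlip
  set E : Fin n → ℝ → ℝ≥0∞ := fun j z => ENNReal.ofReal (Real.exp (ℓ j z)) with hE
  have hℓm : ∀ j, Measurable (ℓ j) := fun j =>
    (LipschitzWith.of_dist_le_mul (K := ε.toNNReal) fun x y => by
      rw [Real.coe_toNNReal _ hεpos.le]
      exact hℓlip j x y).continuous.measurable
  have hEm : ∀ j, Measurable (E j) := fun j =>
    ENNReal.measurable_ofReal.comp (Real.measurable_exp.comp (hℓm j))
  have hvm : ∀ j, Measurable fun u => v u j := fun j => by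
    refine (LipschitzWith.of_dist_le_mul (K := (beta r p j + 2 * κ).toNNReal)
      fun x y => ?_).continuous.measurable
    have hκ0 : 0 < κ := by positivity
    rw [Real.coe_toNNReal _ (by have := hβ j; positivity), Real.dist_eq, Real.dist_eq]
    have h1 := hvlip x y j
    have h2 := abs_add_le (v x j - v y j - beta r p j * (x - y)) (beta r p j * (x - y))
    rw [sub_add_cancel, abs_mul, abs_of_pos (hβ j)] at h2
    linarith
  have hvanti : ∀ j, AntilipschitzWith a fun u => v u j := fun j => by
    refine AntilipschitzWith.of_le_mul_dist fun x y => ?_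
    rw [hab, Real.dist_eq, Real.dist_eq]
    have h1 := hvlip x y j
    have h2 := abs_sub_abs_le_abs_sub (beta r p j * (x - y)) (v x j - v y j)
    rw [abs_sub_comm (beta r p j * (x - y)), abs_mul, abs_of_pos (hβ j)] at h2
    have h3 : b * |x - y| ≤ beta r p j * |x - y| :=
      mul_le_mul_of_nonneg_right (hjb j) (abs_nonneg _)
    rw [div_mul_eq_mul_div, le_div_iff₀ hbpos]
    rw [hκ] at h1
    linarith
  have hprod : ∀ u, ENNReal.ofReal (Real.exp (L u)) = ∏ j, E j (v u j) ^ w j := fun u => by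
    rw [hLdef, Real.exp_sum, ENNReal.ofReal_prod_of_nonneg fun j _ => (Real.exp_pos _).le]
    refine Finset.prod_congr rfl fun j _ => ?_
    rw [hE]
    simp only
    rw [ENNReal.ofReal_rpow_of_pos (Real.exp_pos _), ← Real.exp_mul, mul_comm]
  rw [lorentzNorm, scriptLNorm_eq_exp]
  calc eLpNorm (fun u => ENNReal.ofReal (Real.exp u ^ (1 / q)) * rearrangement f (Real.exp u))
        (meanTheta r θ) volume
      ≤ C.toNNReal • eLpNorm (fun u => ∏ j, E j (v u j) ^ w j) (meanTheta r θ) volume := by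
        refine eLpNorm_le_nnreal_smul_eLpNorm_of_ae_le_mul'
          (Filter.Eventually.of_forall fun u => ?_) _
        simp only [enorm_eq_self]
        rw [← hprod]
        refine (mul_le_mul_right (hrear u) _).trans (le_of_eq ?_)
        change _ = ENNReal.ofReal C * _
        rw [← ENNReal.ofReal_mul (by positivity), ← ENNReal.ofReal_mul hC0, ← Real.exp_mul]
        congr 1
        rw [mul_left_comm, ← Real.exp_add]
        congr 2
        ring
    _ ≤ C.toNNReal • ∏ j, eLpNorm (fun u => E j (v u j)) (θ j) volume ^ w j := by
        gcongr
        exact eLpNorm_prod_rpow_le (g := fun j u => E j (v u j))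
          (fun j => (hEm j).comp (hvm j)) hwpos
          (fun j => (zero_lt_one.trans_le (hθ j)).ne') (meanTheta_inv hn hr θ)
    _ ≤ C.toNNReal • ∏ j, (a * (expMass ε * besovSeminorm j (k j) (r j) (p j) (θ j) f)) ^ w j := by
        gcongr with j
        · exact (hwpos j).le
        refine (eLpNorm_comp_le_of_expanding (hvm j) (hvanti j) ha1 (hθ j) (hEm j)).trans ?_
        gcongr
        rw [besovSeminorm_eq]
        exact hℓnorm j
    _ = _ := by
        rw [ENNReal.coe_mul, ENNReal.coe_toNNReal hconst, ENNReal.smul_def, smul_eq_mul, mul_assoc,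
          ← Finset.prod_mul_distrib]
        congr 1
        refine Finset.prod_congr rfl fun j _ => ?_
        rw [← mul_assoc, ENNReal.mul_rpow_of_nonneg _ _ (hwpos j).le]

end Main

end AnisoBesov

/-! ### Reduction to measurable `f` with positive finite seminorms. -/

open AnisoBesov
theorem theorem2 {𝕜 : Type*} [RCLike 𝕜] (n : ℕ) (hn : 0 < n)
    (r p : Fin n → ℝ) (θ : Fin n → ℝ≥0∞) (k : Fin n → ℕ)
    (hr : ∀ j, 0 < r j) (hp : ∀ j, 1 ≤ p j) (hθ : ∀ j, 1 ≤ θ j)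
    (hk : ∀ j, r j < (k j : ℝ))
    (hβ : ∀ j, 0 < beta r p j) (hpr : meanP r p < n / meanR r) :
    ∃ c : ℝ≥0, ∀ f : (Fin n → ℝ) → 𝕜,
      ((MemS0 f ∧ LocallyIntegrable f volume) ∨
        (∃ p₀ : ℝ, 0 < p₀ ∧ p₀ < qStar r p ∧ MemLp f (ENNReal.ofReal p₀) volume)) →
      lorentzNorm (qStar r p) (meanTheta r θ) f ≤
        c * ∏ j, besovSeminorm j (k j) (r j) (p j) (θ j) f ^ (meanR r / (n * r j)) := by
  obtain ⟨c, hc⟩ := exists_lorentzNorm_le (𝕜 := 𝕜) hn r p θ k hr hp hθ hβ hpr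
  -- A nonzero constant is needed so that the right side is `∞` when some seminorm is infinite and
  -- none vanishes.
  refine ⟨c + 1, fun f hf => ?_⟩
  have hS0 : MemS0 f := by
    rcases hf with h | ⟨p₀, hp₀, _, h⟩
    · exact h.1
    · exact memS0_of_memLp hp₀ h
  obtain ⟨g, hg, hfg⟩ := hS0.1
  have hgm : Measurable g := hg.measurable
  have hgS : ∀ y : ℝ, 0 < y → volume {x | y < ‖g x‖} ≠ ∞ := fun y hy => by
    rw [← distribution_ofReal g hy.le, ← distribution_congr_ae hfg]
    exact (hS0.2 y hy).ne
  rw [lorentzNorm_congr_ae _ _ hfg]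
  simp only [besovSeminorm_congr_ae _ _ _ _ _ hfg]
  by_cases h0 : ∃ j, besovSeminorm j (k j) (r j) (p j) (θ j) g = 0
  · obtain ⟨j, hj⟩ := h0
    rw [lorentzNorm_congr_ae _ _ (ae_eq_zero_of_besovSeminorm_eq_zero hgm hgS j (k j)
      (zero_lt_one.trans_le (hp j)) (zero_lt_one.trans_le (hθ j)).ne' hj), lorentzNorm_zero]
    exact zero_le
  push Not at h0
  by_cases htop : ∃ j, besovSeminorm j (k j) (r j) (p j) (θ j) g = ∞
  · obtain ⟨j, hj⟩ := htop
    have hw : ∀ j, 0 < meanR r / (n * r j) := fun j => by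
      rw [← div_div]
      exact div_pos (meanR_div_pos hn hr) (hr j)
    have hprod : ∏ j, besovSeminorm j (k j) (r j) (p j) (θ j) g ^ (meanR r / (n * r j)) = ∞ := by
      rw [← Finset.mul_prod_erase _ _ (Finset.mem_univ j), hj, ENNReal.top_rpow_of_pos (hw j)]
      refine ENNReal.top_mul (Finset.prod_ne_zero_iff.2 fun i _ => ?_)
      rw [Ne, ENNReal.rpow_eq_zero_iff_of_pos (hw i)]
      exact h0 i
    rw [hprod, ENNReal.mul_top (by simp)]
    exact le_top
  push Not at htop
  refine (hc g hgm hgS h0 htop).trans ?_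
  gcongr
  exact le_self_add
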